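/- Let $d\in\mathbb{N}$ and $T>0$. A locally bounded (possibly signed) Borel measure on $X=\mathbb{R}^d$ or $X=\mathbb{R}^d\times[0,T]$ is a real function on the bounded Borel subsets of $X$ that is countably additive on the Borel subsets of every compact set; $|\cdot|$ denotes its total variation. A locally bounded measure $\mu$ on $\mathbb{R}^d\times[0,T]$ is given by a family $(\mu_t)_{t\in[0,T]}$ of locally bounded measures on $\mathbb{R}^d$ if $t\mapsto\mu_t(B)$ is measurable for every bounded Borel set $B\subset\mathbb{R}^d$, $t\mapsto|\mu_t|(K)$ belongs to $L^1[0,T]$ for every compact $K\subset\mathbb{R}^d$, and $$\int_{\mathbb{R}^d\times[0,T]}u\,d\mu=\int_0^T\int_{\mathbb{R}^d}u(x,t)\,\mu_t(dx)\,dt$$ for all bounded Borel functions $u$ that vanish for $x$ outside some ball. Given a Borel vector field $b$ on $\mathbb{R}^d\times[0,T]$ with values in $\mathbb{R}^d$ and a locally bounded measure $\nu$ on $\mathbb{R}^d$, such a measure $\mu$, given by $(\mu_t)_{t\in[0,T]}$, is a solution of the Cauchy problem $$\partial_t\mu+\operatorname{div}(b\mu)=0,\qquad \mu|_{t=0}=\nu,$$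 if $b\in L^1(|\mu|,U\times[0,T])$ for every ball $U\subset\mathbb{R}^d$ and, for every function $u$ on $\mathbb{R}^d\times[0,T)$ that is continuous together with its first order derivatives in $t$ and $x$ and vanishes for $|x|>R$ for some $R$, the equality $$\int_{\mathbb{R}^d}u(x,t)\,\mu_t(dx)=\int_{\mathbb{R}^d}u(x,0)\,\nu(dx)+\int_0^t\int_{\mathbb{R}^d}\bigl[\partial_su+\langle b,\nabla u\rangle\bigr](x,s)\,\mu_s(dx)\,ds$$ holds for almost every $t\in[0,T]$. Let $\beta\colon[0,+\infty)\to[0,+\infty)$ be bounded and continuous, and suppose that for every $N>0$ there is a number $\Lambda_N>0$ such that $s\mapsto\beta(s)-\Lambda_Ns$ is decreasing on $[0,N]$. Put $b(x)=-\beta(|x|^2)x$ and let $\partial Z$ be the boundary of the set $Z=\{x\in\mathbb{R}^d\colon\beta(|x|^2)=0\}$. Then, for every locally bounded measure $\nu$ on $\mathbb{R}^d$, the above Cauchy problem has at most one solution in the class of all locally bounded measures $\mu$ on $\mathbb{R}^d\times[0,T]$ given by families $(\mu_t)_{t\in[0,T]}$ of locally bounded measures such that $$|\mu_t|(\partial Z\setminus\{0\})=0\quad\text{for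 almost all }t\in[0,T].$$ That is, if $\mu^1$ and $\mu^2$ are two such solutions, then $\mu^1=\mu^2$ and $\mu^1_t=\mu^2_t$ for almost every $t\in[0,T]$. -/

import Mathlib

open MeasureTheory Set

/-- A locally bounded (possibly signed) Borel measure: a real function on the bounded Borel sets
that is countably additive on the Borel subsets of every bounded set (in a proper space, such as
`ℝᵈ` or `ℝᵈ × [0, T]`: of every compact set). The value on all other sets is set to `0`, so that
two such measures are equal as soon as they agree on the bounded Borel sets. -/
structure LocallyBoundedMeasure (X : Type*) [PseudoMetricSpace X] [MeasurableSpace X] where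
  toFun : Set X → ℝ
  eq_zero_of_not : ∀ A, ¬ (MeasurableSet A ∧ Bornology.IsBounded A) → toFun A = 0
  hasSum_iUnion : ∀ A : ℕ → Set X, (∀ i, MeasurableSet (A i)) → Bornology.IsBounded (⋃ i, A i) →
    Pairwise (Function.onFun Disjoint A) → HasSum (fun i => toFun (A i)) (toFun (⋃ i, A i))

namespace LocallyBoundedMeasure

section

variable {X : Type*} [PseudoMetricSpace X] [MeasurableSpace X]

instance : CoeFun (LocallyBoundedMeasure X) (fun _ => Set X → ℝ) := ⟨toFun⟩

theorem apply_empty (m : LocallyBoundedMeasure X) : m ∅ = 0 := by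
  have h := m.hasSum_iUnion (fun _ => ∅) (fun _ => MeasurableSet.empty) (by simp)
    (fun _ _ _ => by simp [Function.onFun])
  exact (summable_const_iff _).1 h.summable

open Classical in
/-- The restriction of `m` to a bounded Borel set `S`, a finite signed measure: `A ↦ m (A ∩ S)`. -/
noncomputable def restrict (m : LocallyBoundedMeasure X) (S : Set X) (hS : MeasurableSet S)
    (hb : Bornology.IsBounded S) : SignedMeasure X where
  measureOf' A := if MeasurableSet A then m (A ∩ S) else 0
  empty' := by simp [apply_empty]
  not_measurable' A hA := by simp [hA]
  m_iUnion' A hA hd := by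
    have h := m.hasSum_iUnion (fun i => A i ∩ S) (fun i => (hA i).inter hS)
      (hb.subset (iUnion_subset fun i => inter_subset_right))
      (fun i j hij => (hd hij).mono inter_subset_left inter_subset_left)
    simpa [hA, MeasurableSet.iUnion hA, iUnion_inter] using h

end

section

/-- A partition of the space into countably many relatively compact Borel sets: the successive
differences of an exhaustion by compact sets. -/
noncomputable def shell (X : Type*) [MetricSpace X] [ProperSpace X] (n : ℕ) : Set X :=
  disjointed (CompactExhaustion.choice X) n

theorem isBounded_shell (X : Type*) [MetricSpace X] [ProperSpace X] (n : ℕ) :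
    Bornology.IsBounded (shell X n) :=
  ((CompactExhaustion.choice X).isCompact n).isBounded.subset (disjointed_le _ n)

variable {X : Type*} [MetricSpace X] [ProperSpace X] [MeasurableSpace X] [BorelSpace X]

variable (X) in
theorem measurableSet_shell (n : ℕ) : MeasurableSet (shell X n) :=
  MeasurableSet.disjointed (fun k => ((CompactExhaustion.choice X).isCompact k).measurableSet) n

/-- The Jordan decomposition of `m` on the `n`-th piece of the partition. -/
noncomputable def jordan (m : LocallyBoundedMeasure X) (n : ℕ) : JordanDecomposition X :=
  (m.restrict (shell X n) (measurableSet_shell X n) (isBounded_shell X n)).toJordanDecomposition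

/-- The positive part `m⁺` of `m`. -/
noncomputable def posPart (m : LocallyBoundedMeasure X) : Measure X :=
  Measure.sum fun n => (m.jordan n).posPart

/-- The negative part `m⁻` of `m`. -/
noncomputable def negPart (m : LocallyBoundedMeasure X) : Measure X :=
  Measure.sum fun n => (m.jordan n).negPart

/-- The total variation `|m| = m⁺ + m⁻`. -/
noncomputable def variation (m : LocallyBoundedMeasure X) : Measure X := m.posPart + m.negPart

/-- The integral `∫ f dm` of a `|m|`-integrable function. -/
noncomputable def integral (m : LocallyBoundedMeasure X) (f : X → ℝ) : ℝ :=
  ∫ x, f x ∂m.posPart - ∫ x, f x ∂m.negPart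

end

end LocallyBoundedMeasure

/-- The locally bounded measure `μ` on `ℝᵈ × [0, T]` is given by the family `(μ_t)`, `t ∈ [0, T]`,
of locally bounded measures on `ℝᵈ`, that is, `μ = μ_t(dx) dt`. -/
structure IsGivenByFamily {d : ℕ} {T : ℝ}
    (μ : LocallyBoundedMeasure (EuclideanSpace ℝ (Fin d) × Icc (0 : ℝ) T))
    (μt : ℝ → LocallyBoundedMeasure (EuclideanSpace ℝ (Fin d))) : Prop where
  measurable : ∀ B : Set (EuclideanSpace ℝ (Fin d)), MeasurableSet B → Bornology.IsBounded B →
    Measurable fun t : Icc (0 : ℝ) T => μt t B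
  integrable_variation : ∀ K : Set (EuclideanSpace ℝ (Fin d)), IsCompact K →
    IntegrableOn (fun t => (μt t).variation.real K) (Icc 0 T)
  integral_eq : ∀ u : EuclideanSpace ℝ (Fin d) → ℝ → ℝ, Measurable (Function.uncurry u) →
    (∃ C, ∀ x t, |u x t| ≤ C) → (∃ R, ∀ x t, R < ‖x‖ → u x t = 0) →
    μ.integral (fun p => u p.1 p.2) = ∫ t in (0 : ℝ)..T, (μt t).integral (fun x => u x t)

/-- The test functions: functions on `ℝᵈ × [0, T)` that are continuous together with their first
order derivatives in `t` and `x` and vanish for `|x| > R` for some `R`. -/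
structure IsTestFunction {d : ℕ} (T : ℝ) (u : EuclideanSpace ℝ (Fin d) → ℝ → ℝ) : Prop where
  continuousOn : ContinuousOn (Function.uncurry u) (univ ×ˢ Ico 0 T)
  differentiable_time : ∀ x, DifferentiableOn ℝ (u x) (Ico 0 T)
  continuousOn_time :
    ContinuousOn (fun p : EuclideanSpace ℝ (Fin d) × ℝ => derivWithin (u p.1) (Ico 0 T) p.2)
      (univ ×ˢ Ico 0 T)
  differentiable_space : ∀ t ∈ Ico 0 T, Differentiable ℝ fun x => u x t
  continuousOn_space :
    ContinuousOn (fun p : EuclideanSpace ℝ (Fin d) × ℝ => gradient (fun x => u x p.2) p.1)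
      (univ ×ˢ Ico 0 T)
  vanishes : ∃ R, ∀ x, ∀ t ∈ Ico 0 T, R < ‖x‖ → u x t = 0

/-- The measure `μ = μ_t(dx) dt` is a solution on `[0, T]` of the Cauchy problem
`∂_t μ + div (b μ) = 0`, `μ|_{t = 0} = ν`. -/
structure IsCauchySolution {d : ℕ} {T : ℝ}
    (b : EuclideanSpace ℝ (Fin d) → ℝ → EuclideanSpace ℝ (Fin d))
    (ν : LocallyBoundedMeasure (EuclideanSpace ℝ (Fin d)))
    (μ : LocallyBoundedMeasure (EuclideanSpace ℝ (Fin d) × Icc (0 : ℝ) T))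
    (μt : ℝ → LocallyBoundedMeasure (EuclideanSpace ℝ (Fin d))) : Prop where
  isGivenByFamily : IsGivenByFamily μ μt
  integrable_drift : ∀ (c : EuclideanSpace ℝ (Fin d)) (r : ℝ),
    IntegrableOn (fun p : EuclideanSpace ℝ (Fin d) × Icc (0 : ℝ) T => b p.1 p.2)
      (Metric.ball c r ×ˢ univ) μ.variation
  equation : ∀ u : EuclideanSpace ℝ (Fin d) → ℝ → ℝ, IsTestFunction T u →
    ∀ᵐ t ∂volume.restrict (Icc 0 T),
      (μt t).integral (fun x => u x t) = ν.integral (fun x => u x 0) +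
        ∫ s in (0 : ℝ)..t, (μt s).integral fun x =>
          derivWithin (u x) (Ico 0 T) s + inner ℝ (b x s) (gradient (fun y => u y s) x)

open Filter Topology

/-! ### Locally bounded measures: null sets, dominated convergence, π-systems -/

namespace LocallyBoundedMeasure

/-! Trajectories of `x' = -β(|x|²) x` stay on rays, and `s = |x|²` satisfies `s' = -2 β(s) s`. So
space splits into radial pieces: the origin, `∂Z \ {0}`, the interior of `Z`, and the shells `{|x|²
∈ J}`, where `J` is a component of `{s > 0 | β s > 0}`. Countably many shells suffice. On `∂Z \ {0}`
both solutions vanish by assumption, and it remains to show on each other piece that two solutions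
agree at almost every time.

The common tool is `ae_integral_eq_of_tendsto`. Suppose that test functions `u n` converge to `v`
and that their derivatives along `(b, 1)` are uniformly bounded and tend to `0`, both limits being
taken off a set null for the two solutions. The terms with `ν` cancel, and dominated convergence
shows that `∫ v dμ_t` is the same for both. Then `ae_eq_of_integral_eq` passes from integrals to
Borel sets.

On the interior of `Z` the field vanishes, so static functions do. At the origin, radial cutoffs on
scale `ε` in `s` have transport derivative of order `s β(s) / ε`, which is bounded for `s ≤ 2ε`. On
a shell the test functions are `w n (|x|²) ψ(F_t x)`, where `F_t` is constant along trajectories and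
`w n` cuts off near the ends of `J`. The one-sided Lipschitz condition gives `β s ≤ Λ (s - a)` only
to the right of a zero `a`, so every cutoff acts to the right of its endpoint
(`exists_abs_mul_deriv_smoothStep_le`). Hence at a finite upper end `c` of `J` the limit cutoff
still contains the sphere `|x|² = c`. This sphere lies in `∂Z \ {0}`, which is where the assumption
on that set is needed.

To the right of `c` the true straightening map may be undefined. Replacing `β` by `max β δ` makes it
`C¹` away from the origin; the error in the conservation law is bounded and disappears on the shell
as `δ → 0`. -/

theorem eq_of_forall {X : Type*} [PseudoMetricSpace X] [MeasurableSpace X]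
    {m m' : LocallyBoundedMeasure X}
    (h : ∀ A, MeasurableSet A → Bornology.IsBounded A → m A = m' A) : m = m' := by
  obtain ⟨f, hf, hf'⟩ := m
  obtain ⟨g, hg, hg'⟩ := m'
  have : f = g := by
    funext A
    by_cases hA : MeasurableSet A ∧ Bornology.IsBounded A
    · exact h A hA.1 hA.2
    · rw [hf A hA, hg A hA]
  subst this
  rfl

theorem apply_diff {X : Type*} [PseudoMetricSpace X] [MeasurableSpace X]
    (m : LocallyBoundedMeasure X) {A B : Set X} (hA : MeasurableSet A) (hB : MeasurableSet B)
    (hb : Bornology.IsBounded A) (hBA : B ⊆ A) : m (A \ B) = m A - m B := by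
  have h := m.restrict A hA hb |>.of_add_of_sdiff hB hA hBA
  have e : ∀ S, MeasurableSet S → m.restrict A hA hb S = m (S ∩ A) := fun S hS => by
    simp [restrict, hS]
  rw [e _ hB, e _ hA, e _ (hA.diff hB), inter_self, inter_eq_left.2 hBA,
    inter_eq_left.2 sdiff_subset] at h
  linarith

variable {X : Type*} [MetricSpace X] [ProperSpace X]

/-- The closure of a bounded set is compact, hence lies in one member of the exhaustion, and later
shells avoid that member. This makes the sums defining `posPart` and `negPart` finite on bounded
sets. -/
theorem exists_disjoint_shell {B : Set X} (hB : Bornology.IsBounded B) :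
    ∃ n, ∀ k, n ≤ k → Disjoint (shell X k) B := by
  obtain ⟨n, hn⟩ := (CompactExhaustion.choice X).exists_superset_of_isCompact hB.isCompact_closure
  refine ⟨n + 1, fun k hk => ?_⟩
  rw [Set.disjoint_left]
  intro x hx hxB
  have hxn : x ∈ CompactExhaustion.choice X n := hn (subset_closure hxB)
  rw [shell, disjointed_apply] at hx
  exact hx.2 (Finset.le_sup (f := fun i => (CompactExhaustion.choice X : ℕ → Set X) i)
    (Finset.mem_Iio.2 hk) hxn)

theorem iUnion_shell : ⋃ n, shell X n = univ := by
  simp only [shell]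
  rw [iUnion_disjointed]
  exact (CompactExhaustion.choice X).iUnion_eq

variable [MeasurableSpace X] [BorelSpace X] (m : LocallyBoundedMeasure X)

theorem restrict_shell_apply (n : ℕ) {A : Set X} (hA : MeasurableSet A) :
    m.restrict (shell X n) (measurableSet_shell X n) (isBounded_shell X n) A
      = m (A ∩ shell X n) := by
  simp [restrict, hA]

theorem jordan_real_sub (n : ℕ) {A : Set X} (hA : MeasurableSet A) :
    (m.jordan n).posPart.real A - (m.jordan n).negPart.real A = m (A ∩ shell X n) := by
  rw [← restrict_shell_apply m n hA]
  conv_rhs => rw [← SignedMeasure.toSignedMeasure_toJordanDecomposition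
    (m.restrict (shell X n) (measurableSet_shell X n) (isBounded_shell X n))]
  rw [JordanDecomposition.toSignedMeasure, Measure.toSignedMeasure_sub_apply hA]
  rfl

/-- On a Hahn set `i` the positive part of `N` is the signed mass of `i ∩ N`, and on its complement
the negative part is minus the signed mass, so vanishing on all Borel subsets kills both parts. -/
theorem jordan_eq_zero (n : ℕ) {N : Set X} (hN : MeasurableSet N)
    (h : ∀ A, MeasurableSet A → A ⊆ N → m (A ∩ shell X n) = 0) :
    (m.jordan n).posPart N = 0 ∧ (m.jordan n).negPart N = 0 := by
  obtain ⟨i, hi₁, hi₂, hi₃, hμ, hν⟩ := (m.restrict (shell X n) (measurableSet_shell X n)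
    (isBounded_shell X n)).toJordanDecomposition_spec
  constructor
  · have hr := SignedMeasure.toMeasureOfZeroLE_real_apply _ hi₂ hi₁ hN
    rw [restrict_shell_apply m n (hi₁.inter hN), h _ (hi₁.inter hN) inter_subset_right,
      ← hμ] at hr
    exact (measureReal_eq_zero_iff (measure_ne_top _ _)).1 hr
  · have hr := SignedMeasure.toMeasureOfLEZero_real_apply _ hi₃ hi₁.compl hN
    rw [restrict_shell_apply m n (hi₁.compl.inter hN),
      h _ (hi₁.compl.inter hN) inter_subset_right, ← hν, neg_zero] at hr
    exact (measureReal_eq_zero_iff (measure_ne_top _ _)).1 hr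

theorem posPart_eq_zero {N : Set X} (hN : MeasurableSet N)
    (h : ∀ A, MeasurableSet A → A ⊆ N → Bornology.IsBounded A → m A = 0) : m.posPart N = 0 := by
  rw [posPart, Measure.sum_apply _ hN, ENNReal.tsum_eq_zero]
  exact fun n => (m.jordan_eq_zero n hN fun A hA hAN => h _ (hA.inter (measurableSet_shell X n))
    (inter_subset_left.trans hAN) ((isBounded_shell X n).subset inter_subset_right)).1

theorem negPart_eq_zero {N : Set X} (hN : MeasurableSet N)
    (h : ∀ A, MeasurableSet A → A ⊆ N → Bornology.IsBounded A → m A = 0) : m.negPart N = 0 := by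
  rw [negPart, Measure.sum_apply _ hN, ENNReal.tsum_eq_zero]
  exact fun n => (m.jordan_eq_zero n hN fun A hA hAN => h _ (hA.inter (measurableSet_shell X n))
    (inter_subset_left.trans hAN) ((isBounded_shell X n).subset inter_subset_right)).2

theorem jordan_eq_zero_of_disjoint (n : ℕ) {N : Set X} (hN : MeasurableSet N)
    (h : Disjoint (shell X n) N) :
    (m.jordan n).posPart N = 0 ∧ (m.jordan n).negPart N = 0 := by
  refine m.jordan_eq_zero n hN fun A _ hAN => ?_
  rw [(h.symm.mono_left hAN).inter_eq, apply_empty]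

theorem posPart_apply_eq_sum {N : Set X} (hN : MeasurableSet N) (n : ℕ)
    (h : ∀ k, n ≤ k → Disjoint (shell X k) N) :
    m.posPart N = ∑ k ∈ Finset.range n, (m.jordan k).posPart N := by
  rw [posPart, Measure.sum_apply _ hN]
  refine tsum_eq_sum fun k hk => (m.jordan_eq_zero_of_disjoint k hN (h k ?_)).1
  simpa using hk

theorem negPart_apply_eq_sum {N : Set X} (hN : MeasurableSet N) (n : ℕ)
    (h : ∀ k, n ≤ k → Disjoint (shell X k) N) :
    m.negPart N = ∑ k ∈ Finset.range n, (m.jordan k).negPart N := by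
  rw [negPart, Measure.sum_apply _ hN]
  refine tsum_eq_sum fun k hk => (m.jordan_eq_zero_of_disjoint k hN (h k ?_)).2
  simpa using hk

instance : IsFiniteMeasureOnCompacts m.posPart where
  lt_top_of_isCompact K hK := by
    obtain ⟨n, hn⟩ := exists_disjoint_shell hK.isBounded
    rw [m.posPart_apply_eq_sum hK.measurableSet n hn]
    exact ENNReal.sum_lt_top.2 fun k _ => measure_lt_top _ _

instance : IsFiniteMeasureOnCompacts m.negPart where
  lt_top_of_isCompact K hK := by
    obtain ⟨n, hn⟩ := exists_disjoint_shell hK.isBounded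
    rw [m.negPart_apply_eq_sum hK.measurableSet n hn]
    exact ENNReal.sum_lt_top.2 fun k _ => measure_lt_top _ _

theorem real_posPart_sub_negPart {A : Set X} (hA : MeasurableSet A)
    (hb : Bornology.IsBounded A) : m.posPart.real A - m.negPart.real A = m A := by
  obtain ⟨n, hn⟩ := exists_disjoint_shell hb
  rw [measureReal_def, measureReal_def, m.posPart_apply_eq_sum hA n hn,
    m.negPart_apply_eq_sum hA n hn, ENNReal.toReal_sum fun k _ => measure_ne_top _ _,
    ENNReal.toReal_sum fun k _ => measure_ne_top _ _, ← Finset.sum_sub_distrib]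
  have hU : ⋃ k, A ∩ shell X k = A := by rw [← inter_iUnion, iUnion_shell, inter_univ]
  have hs := m.hasSum_iUnion (fun k => A ∩ shell X k)
    (fun k => hA.inter (measurableSet_shell X k)) (by rwa [hU])
    (fun i j hij => (disjoint_disjointed (CompactExhaustion.choice X) hij).mono
      inter_subset_right inter_subset_right)
  rw [hU] at hs
  rw [← hs.tsum_eq, tsum_eq_sum (s := Finset.range n)]
  · exact Finset.sum_congr rfl fun k _ => m.jordan_real_sub k hA
  · intro k hk
    rw [((hn k (by simpa using hk)).symm).inter_eq, apply_empty]

theorem integral_indicator_one {A : Set X} (hA : MeasurableSet A)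
    (hb : Bornology.IsBounded A) : m.integral (A.indicator fun _ => 1) = m A := by
  rw [integral, integral_indicator hA, integral_indicator hA]
  simp only [setIntegral_const, smul_eq_mul, mul_one]
  exact m.real_posPart_sub_negPart hA hb

/-- Dominated convergence for a locally bounded measure. -/
theorem tendsto_integral {f : ℕ → X → ℝ} {g : X → ℝ} {N K : Set X} {C : ℝ} (hN : MeasurableSet N)
    (hmN : ∀ A, MeasurableSet A → A ⊆ N → Bornology.IsBounded A → m A = 0)
    (hf : ∀ n, Measurable (f n)) (hK : IsCompact K) (hfK : ∀ n, ∀ x ∉ K, f n x = 0)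
    (hC : ∀ n x, |f n x| ≤ C) (hlim : ∀ x ∉ N, Tendsto (fun n => f n x) atTop (𝓝 (g x))) :
    Tendsto (fun n => m.integral (f n)) atTop (𝓝 (m.integral g)) := by
  have hb : ∀ n x, ‖f n x‖ ≤ K.indicator (fun _ => C) x := fun n x => by
    by_cases hx : x ∈ K
    · simpa [hx] using hC n x
    · simp [hx, hfK n x hx]
  have key : ∀ (ρ : Measure X) [IsFiniteMeasureOnCompacts ρ], ρ N = 0 →
      Tendsto (fun n => ∫ x, f n x ∂ρ) atTop (𝓝 (∫ x, g x ∂ρ)) := by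
    intro ρ _ hρ
    refine tendsto_integral_of_dominated_convergence (K.indicator fun _ => C)
      (fun n => (hf n).aestronglyMeasurable) ?_ (fun n => ae_of_all _ (hb n)) ?_
    · rw [integrable_indicator_iff hK.measurableSet]
      exact integrableOn_const hK.measure_lt_top.ne
    · have : ∀ᵐ x ∂ρ, x ∉ N := measure_eq_zero_iff_ae_notMem.1 hρ
      filter_upwards [this] with x hx using hlim x hx
  exact (key _ (m.posPart_eq_zero hN hmN)).sub (key _ (m.negPart_eq_zero hN hmN))

theorem apply_eq_zero_of_variation {N A : Set X} (hN : m.variation N = 0) (hA : MeasurableSet A)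
    (hb : Bornology.IsBounded A) (hAN : A ⊆ N) : m A = 0 := by
  rw [variation, Measure.add_apply, add_eq_zero] at hN
  rw [← m.real_posPart_sub_negPart hA hb, measureReal_def, measureReal_def,
    measure_mono_null hAN hN.1, measure_mono_null hAN hN.2]
  simp

/-- Two locally bounded measures whose images under `G` of the restrictions to a bounded set `W`
agree on a π-system that contains the whole space agree on all preimages of measurable sets. -/
theorem apply_inter_preimage_eq {X Y : Type*} [PseudoMetricSpace X] [MeasurableSpace X]
    [mY : MeasurableSpace Y] {𝒞 : Set (Set Y)}
    {m m' : LocallyBoundedMeasure X} (h𝒞 : mY = MeasurableSpace.generateFrom 𝒞)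
    (hpi : IsPiSystem 𝒞) {G : X → Y} (hG : Measurable G) {W : Set X} (hW : MeasurableSet W)
    (hb : Bornology.IsBounded W) (huniv : m W = m' W)
    (h : ∀ V ∈ 𝒞, m (W ∩ G ⁻¹' V) = m' (W ∩ G ⁻¹' V)) {V : Set Y} (hV : MeasurableSet V) :
    m (W ∩ G ⁻¹' V) = m' (W ∩ G ⁻¹' V) := by
  induction V, hV using MeasurableSpace.induction_on_inter h𝒞 hpi with
  | empty => simp [apply_empty]
  | basic t ht => exact h t ht
  | compl t ht ih =>
    have e : W ∩ G ⁻¹' tᶜ = W \ (W ∩ G ⁻¹' t) := by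
      rw [sdiff_self_inter, preimage_compl]; rfl
    rw [e, m.apply_diff hW (hW.inter (hG ht)) hb inter_subset_left,
      m'.apply_diff hW (hW.inter (hG ht)) hb inter_subset_left, ih, huniv]
  | iUnion f hd hf ih =>
    rw [preimage_iUnion, inter_iUnion]
    have hs : ∀ p : LocallyBoundedMeasure X, HasSum (fun i => p (W ∩ G ⁻¹' f i))
        (p (⋃ i, W ∩ G ⁻¹' f i)) := fun p =>
      p.hasSum_iUnion _ (fun i => hW.inter (hG (hf i)))
        (hb.subset (iUnion_subset fun i => inter_subset_left))
        (fun i j hij => ((hd hij).preimage G).mono inter_subset_right inter_subset_right)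
    have h2 := hs m'
    simp only [← ih] at h2
    exact (hs m).unique h2

end LocallyBoundedMeasure

/-- Finite intersections of a countable basis; the empty intersection supplies `univ`. Countability
lets a single null set of times serve all members. -/
theorem exists_countable_piSystem_of_isOpen (E : Type*) [TopologicalSpace E]
    [SecondCountableTopology E] [MeasurableSpace E] [hE : BorelSpace E] :
    ∃ 𝒞 : Set (Set E), 𝒞.Countable ∧ (∀ U ∈ 𝒞, IsOpen U) ∧ univ ∈ 𝒞 ∧ IsPiSystem 𝒞 ∧
      ‹MeasurableSpace E› = MeasurableSpace.generateFrom 𝒞 := by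
  obtain ⟨b, hbc, -, hb⟩ := TopologicalSpace.exists_countable_basis E
  have h := TopologicalSpace.isTopologicalBasis_of_subbasis hb.eq_generateFrom
  refine ⟨_, (countable_ofPred_finite_subset hbc).image _, fun U hU => h.isOpen hU,
    ⟨∅, by simp, by simp⟩, ?_, ?_⟩
  · rintro _ ⟨S, hS, rfl⟩ _ ⟨S', hS', rfl⟩ -
    exact ⟨S ∪ S', ⟨hS.1.union hS'.1, union_subset hS.2 hS'.2⟩, sInter_union S S'⟩
  · rw [hE.measurable_eq]
    exact h.borel_eq_generateFrom

/-! ### The equation tested against `C¹` functions -/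

section

variable {d : ℕ} {T : ℝ}

theorem IsGivenByFamily.apply_eq (hT : 0 ≤ T)
    {μ : LocallyBoundedMeasure (EuclideanSpace ℝ (Fin d) × Icc (0 : ℝ) T)}
    {μt : ℝ → LocallyBoundedMeasure (EuclideanSpace ℝ (Fin d))} (h : IsGivenByFamily μ μt)
    {A : Set (EuclideanSpace ℝ (Fin d) × Icc (0 : ℝ) T)} (hA : MeasurableSet A)
    (hb : Bornology.IsBounded A) :
    μ A = ∫ t in (0 : ℝ)..T, μt t {x | (x, projIcc 0 T hT t) ∈ A} := by
  -- The family identity wants a function of every real time, while `A` lives over `[0, T]`;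
  -- `projIcc` extends it without changing anything on `[0, T]`.
  have hm : Measurable fun p : EuclideanSpace ℝ (Fin d) × ℝ => (p.1, projIcc 0 T hT p.2) :=
    measurable_fst.prodMk ((continuous_projIcc (h := hT)).measurable.comp measurable_snd)
  obtain ⟨R, hR⟩ := hb.image_fst.subset_closedBall 0
  have hR' : ∀ x s, (x, s) ∈ A → ‖x‖ ≤ R := fun x s hp =>
    mem_closedBall_zero_iff.1 (hR (mem_image_of_mem Prod.fst hp))
  have hu : Measurable (Function.uncurry fun x t =>
      A.indicator (fun _ => (1 : ℝ)) (x, projIcc 0 T hT t)) :=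
    (measurable_const.indicator hA).comp hm
  have hC : ∀ x t, |A.indicator (fun _ => (1 : ℝ)) (x, projIcc 0 T hT t)| ≤ 1 := fun x t => by
    by_cases hx : (x, projIcc 0 T hT t) ∈ A
    · rw [indicator_of_mem hx, abs_one]
    · rw [indicator_of_notMem hx, abs_zero]
      exact zero_le_one
  have hv : ∀ x t, R < ‖x‖ → A.indicator (fun _ => (1 : ℝ)) (x, projIcc 0 T hT t) = 0 :=
    fun x t hx => indicator_of_notMem (fun hp => (hR' x _ hp).not_gt hx) _
  have key := h.integral_eq (fun x t => A.indicator (fun _ => (1 : ℝ)) (x, projIcc 0 T hT t))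
    hu ⟨1, hC⟩ ⟨R, hv⟩
  rw [← μ.integral_indicator_one hA hb]
  convert key using 1
  · congr 1
    funext p
    rw [projIcc_val]
  · refine intervalIntegral.integral_congr fun t _ => ?_
    have hS : MeasurableSet {x | (x, projIcc 0 T hT t) ∈ A} :=
      measurable_id.prodMk measurable_const hA
    have hSb : Bornology.IsBounded {x | (x, projIcc 0 T hT t) ∈ A} :=
      (Metric.isBounded_closedBall (x := (0 : EuclideanSpace ℝ (Fin d))) (r := R)).subset
        fun x hx => mem_closedBall_zero_iff.2 (hR' x _ hx)
    refine ((μt t).integral_indicator_one hS hSb).symm.trans ?_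
    congr 1

theorem IsGivenByFamily.apply_eq_zero (hT : 0 ≤ T)
    {μ : LocallyBoundedMeasure (EuclideanSpace ℝ (Fin d) × Icc (0 : ℝ) T)}
    {μt : ℝ → LocallyBoundedMeasure (EuclideanSpace ℝ (Fin d))} (h : IsGivenByFamily μ μt)
    {N : Set (EuclideanSpace ℝ (Fin d))}
    (hN : ∀ᵐ t ∂volume.restrict (Icc 0 T), (μt t).variation N = 0)
    {A : Set (EuclideanSpace ℝ (Fin d) × Icc (0 : ℝ) T)} (hA : MeasurableSet A)
    (hAN : A ⊆ N ×ˢ univ) (hb : Bornology.IsBounded A) : μ A = 0 := by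
  rw [h.apply_eq hT hA hb, intervalIntegral.integral_of_le hT]
  refine integral_eq_zero_of_ae ?_
  filter_upwards [ae_mono (Measure.restrict_mono Ioc_subset_Icc_self le_rfl) hN] with t ht
  refine (μt t).apply_eq_zero_of_variation ht
    (measurable_id.prodMk measurable_const hA) ?_ fun x hx => (hAN hx).1
  exact hb.image_fst.subset fun x hx => ⟨_, hx, rfl⟩

theorem hasFDerivAt_uncurry_left {u : EuclideanSpace ℝ (Fin d) → ℝ → ℝ}
    (hu : ContDiff ℝ 1 (Function.uncurry u)) (x : EuclideanSpace ℝ (Fin d)) (t : ℝ) :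
    HasFDerivAt (fun y => u y t) ((fderiv ℝ (Function.uncurry u) (x, t)).comp
      (ContinuousLinearMap.inl ℝ _ ℝ)) x :=
  HasFDerivAt.comp (g := Function.uncurry u) (f := fun y => (y, t)) x
    (hu.differentiable one_ne_zero (x, t)).hasFDerivAt (hasFDerivAt_prodMk_left x t)

theorem hasDerivAt_uncurry_right {u : EuclideanSpace ℝ (Fin d) → ℝ → ℝ}
    (hu : ContDiff ℝ 1 (Function.uncurry u)) (x : EuclideanSpace ℝ (Fin d)) (t : ℝ) :
    HasDerivAt (u x) (fderiv ℝ (Function.uncurry u) (x, t) (0, 1)) t := by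
  have := (HasFDerivAt.comp (g := Function.uncurry u) t
    (hu.differentiable one_ne_zero (x, t)).hasFDerivAt (hasFDerivAt_prodMk_right x t)).hasDerivAt
  simpa using! this

theorem derivWithin_uncurry_right {u : EuclideanSpace ℝ (Fin d) → ℝ → ℝ}
    (hu : ContDiff ℝ 1 (Function.uncurry u)) (x : EuclideanSpace ℝ (Fin d)) {t : ℝ}
    (ht : t ∈ Ico 0 T) :
    derivWithin (u x) (Ico 0 T) t = fderiv ℝ (Function.uncurry u) (x, t) (0, 1) :=
  (hasDerivAt_uncurry_right hu x t).hasDerivWithinAt.derivWithin (uniqueDiffOn_Ico 0 T t ht)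

theorem isTestFunction_of_contDiff {u : EuclideanSpace ℝ (Fin d) → ℝ → ℝ}
    (hu : ContDiff ℝ 1 (Function.uncurry u)) {R : ℝ}
    (hR : ∀ x, ∀ t ∈ Icc 0 T, R < ‖x‖ → u x t = 0) : IsTestFunction T u where
  continuousOn := hu.continuous.continuousOn
  differentiable_time x t _ :=
    (hasDerivAt_uncurry_right hu x t).differentiableAt.differentiableWithinAt
  continuousOn_time := by
    refine ContinuousOn.congr (f := fun p => fderiv ℝ (Function.uncurry u) p (0, 1)) ?_
      fun p hp => derivWithin_uncurry_right hu p.1 hp.2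
    exact ((hu.continuous_fderiv one_ne_zero).clm_apply continuous_const).continuousOn
  differentiable_space t _ x := (hasFDerivAt_uncurry_left hu x t).differentiableAt
  continuousOn_space := by
    have : (fun p : EuclideanSpace ℝ (Fin d) × ℝ => gradient (fun x => u x p.2) p.1) =
        fun p => (InnerProductSpace.toDual ℝ _).symm ((fderiv ℝ (Function.uncurry u) p).comp
          (ContinuousLinearMap.inl ℝ _ ℝ)) := by
      funext p
      rw [gradient, (hasFDerivAt_uncurry_left hu p.1 p.2).fderiv]
    rw [this]
    exact ((LinearIsometryEquiv.continuous _).comp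
      ((hu.continuous_fderiv one_ne_zero).clm_comp continuous_const)).continuousOn
  vanishes := ⟨R, fun x t ht hx => hR x t (Ico_subset_Icc_self ht) hx⟩

theorem drift_derivative_eq {u : EuclideanSpace ℝ (Fin d) → ℝ → ℝ}
    (hu : ContDiff ℝ 1 (Function.uncurry u)) (x v : EuclideanSpace ℝ (Fin d)) {t : ℝ}
    (ht : t ∈ Ico 0 T) :
    derivWithin (u x) (Ico 0 T) t + inner ℝ v (gradient (fun y => u y t) x) =
      fderiv ℝ (Function.uncurry u) (x, t) (v, 1) := by
  rw [derivWithin_uncurry_right hu x ht, real_inner_comm, gradient,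
    InnerProductSpace.toDual_symm_apply, (hasFDerivAt_uncurry_left hu x t).fderiv,
    ContinuousLinearMap.comp_apply, ContinuousLinearMap.inl_apply, ← map_add]
  simp

/-- Transport derivatives can thus be computed along the straight line with the velocity frozen at
`x`, without gradients or an actual flow. -/
theorem hasDerivAt_along {u : EuclideanSpace ℝ (Fin d) → ℝ → ℝ}
    (hu : ContDiff ℝ 1 (Function.uncurry u)) (x v : EuclideanSpace ℝ (Fin d)) (t : ℝ) :
    HasDerivAt (fun ε : ℝ => u (x + ε • v) (t + ε))
      (fderiv ℝ (Function.uncurry u) (x, t) (v, 1)) 0 := by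
  have h1 : HasDerivAt (fun ε : ℝ => (x + ε • v, t + ε)) (v, (1 : ℝ)) 0 := by
    refine HasDerivAt.prodMk ?_ ((hasDerivAt_id 0).const_add t)
    simpa using! ((hasDerivAt_id (0 : ℝ)).smul_const v).const_add x
  have h2 : HasFDerivAt (Function.uncurry u) (fderiv ℝ (Function.uncurry u) (x, t))
      (x + (0 : ℝ) • v, t + 0) := by
    simpa using (hu.differentiable one_ne_zero (x, t)).hasFDerivAt
  exact h2.comp_hasDerivAt 0 h1

theorem measurable_fderiv_apply {u : EuclideanSpace ℝ (Fin d) → ℝ → ℝ}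
    (hu : ContDiff ℝ 1 (Function.uncurry u))
    {b : EuclideanSpace ℝ (Fin d) → EuclideanSpace ℝ (Fin d)} (hb : Measurable b) :
    Measurable fun p : EuclideanSpace ℝ (Fin d) × ℝ =>
      fderiv ℝ (Function.uncurry u) p (b p.1, 1) := by
  have hc : Continuous fun q : (EuclideanSpace ℝ (Fin d) × ℝ) ×
      (EuclideanSpace ℝ (Fin d) × ℝ) => fderiv ℝ (Function.uncurry u) q.1 q.2 :=
    ((hu.continuous_fderiv one_ne_zero).comp continuous_fst).clm_apply continuous_snd
  exact hc.measurable.comp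
    (measurable_id.prodMk ((hb.comp measurable_fst).prodMk measurable_const))

theorem fderiv_eq_zero_of_vanishes {u : EuclideanSpace ℝ (Fin d) → ℝ → ℝ} {R : ℝ}
    (hR : ∀ x, ∀ t ∈ Icc 0 T, R < ‖x‖ → u x t = 0) {x : EuclideanSpace ℝ (Fin d)} {t : ℝ}
    (ht : t ∈ Ioo 0 T) (hx : R < ‖x‖) (v : EuclideanSpace ℝ (Fin d) × ℝ) :
    fderiv ℝ (Function.uncurry u) (x, t) v = 0 := by
  have : Function.uncurry u =ᶠ[𝓝 (x, t)] fun _ => 0 := by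
    have h1 : ∀ᶠ p : EuclideanSpace ℝ (Fin d) × ℝ in 𝓝 (x, t), R < ‖p.1‖ :=
      (continuous_fst.norm.tendsto (x, t)).eventually (lt_mem_nhds hx)
    have h2 : ∀ᶠ p : EuclideanSpace ℝ (Fin d) × ℝ in 𝓝 (x, t), p.2 ∈ Ioo 0 T :=
      (continuous_snd.tendsto (x, t)).eventually (isOpen_Ioo.mem_nhds ht)
    filter_upwards [h1, h2] with p hp hp' using hR p.1 p.2 (Ioo_subset_Icc_self hp') hp
  rw [this.fderiv_eq]
  simp

/-- Writes the iterated integral as one integral against `μ`, so that limits can be taken by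
dominated convergence in space-time. The bounds on the support and on the transport derivative make
the integrand admissible in the identity `μ = μ_t dt`; the open interval `(0, t)` avoids the
endpoints, where the behaviour of `u` outside `[0, T]` would matter. -/
theorem IsCauchySolution.equation_of_contDiff (hT : 0 ≤ T)
    {b : EuclideanSpace ℝ (Fin d) → EuclideanSpace ℝ (Fin d)} (hb : Measurable b)
    {ν : LocallyBoundedMeasure (EuclideanSpace ℝ (Fin d))}
    {μ : LocallyBoundedMeasure (EuclideanSpace ℝ (Fin d) × Icc (0 : ℝ) T)}
    {μt : ℝ → LocallyBoundedMeasure (EuclideanSpace ℝ (Fin d))}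
    (h : IsCauchySolution (fun x _ => b x) ν μ μt) {u : EuclideanSpace ℝ (Fin d) → ℝ → ℝ}
    (hu : ContDiff ℝ 1 (Function.uncurry u)) {R C : ℝ} (hC : 0 ≤ C)
    (hR : ∀ x, ∀ t ∈ Icc 0 T, R < ‖x‖ → u x t = 0)
    (hfC : ∀ x, ∀ t ∈ Ioo 0 T, |fderiv ℝ (Function.uncurry u) (x, t) (b x, 1)| ≤ C) :
    ∀ᵐ t ∂volume.restrict (Icc 0 T), (μt t).integral (fun x => u x t) =
      ν.integral (fun x => u x 0) + μ.integral fun p =>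
        (Ioo 0 t).indicator (fun s => fderiv ℝ (Function.uncurry u) (p.1, s) (b p.1, 1)) p.2 := by
  filter_upwards [h.equation u (isTestFunction_of_contDiff hu hR),
    ae_restrict_mem measurableSet_Icc] with t ht htT
  rw [ht]
  congr 1
  have hIoo : ∀ s ∈ Ioo 0 t, s ∈ Ioo 0 T := fun s hs => ⟨hs.1, hs.2.trans_le htT.2⟩
  rw [h.isGivenByFamily.integral_eq
    (fun x s => (Ioo 0 t).indicator
      (fun s => fderiv ℝ (Function.uncurry u) (x, s) (b x, 1)) s),
    intervalIntegral.integral_of_le hT, intervalIntegral.integral_of_le htT.1,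
    integral_Ioc_eq_integral_Ioo, integral_Ioc_eq_integral_Ioo]
  · have e : (fun s => (μt s).integral fun x => (Ioo 0 t).indicator
        (fun s => fderiv ℝ (Function.uncurry u) (x, s) (b x, 1)) s) =
        (Ioo 0 t).indicator fun s => (μt s).integral fun x =>
          fderiv ℝ (Function.uncurry u) (x, s) (b x, 1) := by
      funext s
      by_cases hs : s ∈ Ioo 0 t
      · simp [indicator_of_mem hs]
      · simp [indicator_of_notMem hs, LocallyBoundedMeasure.integral]
    rw [e, setIntegral_indicator measurableSet_Ioo, inter_eq_right.2 hIoo]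
    refine setIntegral_congr_fun measurableSet_Ioo fun s hs => ?_
    have hs' := Ioo_subset_Ico_self (hIoo s hs)
    simp only [drift_derivative_eq hu _ _ hs']
  · have : Function.uncurry (fun x s => (Ioo 0 t).indicator
        (fun s => fderiv ℝ (Function.uncurry u) (x, s) (b x, 1)) s) =
        (Prod.snd ⁻¹' Ioo 0 t).indicator
          fun p => fderiv ℝ (Function.uncurry u) p (b p.1, 1) := by
      funext p
      rfl
    rw [this]
    exact (measurable_fderiv_apply hu hb).indicator (measurable_snd measurableSet_Ioo)
  · refine ⟨C, fun x s => ?_⟩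
    by_cases hs : s ∈ Ioo 0 t
    · rw [indicator_of_mem hs]
      exact hfC x s (hIoo s hs)
    · rw [indicator_of_notMem hs, abs_zero]
      exact hC
  · refine ⟨R, fun x s hx => ?_⟩
    by_cases hs : s ∈ Ioo 0 t
    · rw [indicator_of_mem hs]
      exact fderiv_eq_zero_of_vanishes hR (hIoo s hs) hx _
    · exact indicator_of_notMem hs _

/-- Take a smooth `f ≥ 0` that is positive exactly on `V`: `smoothTransition (k * f)` becomes `1` as
soon as `k * f ≥ 1`. -/
theorem exists_seq_contDiff_tendsto_indicator {V : Set (EuclideanSpace ℝ (Fin d))}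
    (hV : IsOpen V) : ∃ ψ : ℕ → EuclideanSpace ℝ (Fin d) → ℝ, (∀ k, ContDiff ℝ 1 (ψ k)) ∧
      (∀ k, Function.support (ψ k) ⊆ V) ∧ (∀ k x, 0 ≤ ψ k x ∧ ψ k x ≤ 1) ∧
      ∀ x, Tendsto (fun k => ψ k x) atTop (𝓝 (V.indicator (fun _ => 1) x)) := by
  obtain ⟨f, hfV, hf, hf01⟩ := hV.exists_contDiff_support_eq (n := 1)
  have hf0 : ∀ x ∉ V, f x = 0 := fun x hx => by
    rwa [← hfV, Function.notMem_support] at hx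
  refine ⟨fun k x => Real.smoothTransition (k * f x),
    fun k => Real.smoothTransition.contDiff.comp (contDiff_const.mul hf), fun k x hx => ?_,
    fun k x => ⟨Real.smoothTransition.nonneg _, Real.smoothTransition.le_one _⟩, fun x => ?_⟩
  · by_contra hxV
    simp [hf0 x hxV] at hx
  · by_cases hx : x ∈ V
    · rw [indicator_of_mem hx]
      have hpos : 0 < f x := lt_of_le_of_ne (hf01 (mem_range_self x)).1 fun h0 => by
        rw [← hfV, Function.mem_support] at hx
        exact hx h0.symm
      refine tendsto_const_nhds.congr' ?_
      filter_upwards [(tendsto_natCast_atTop_atTop.atTop_mul_const hpos).eventually_ge_atTop 1]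
        with k hk
      exact (Real.smoothTransition.one_of_one_le hk).symm
    · simp [hx, hf0 x hx]

end

/-! ### Comparing two solutions: limits of test functions and recovery of Borel sets -/

section

variable {d : ℕ} {T : ℝ}

/-- For every `n` the difference between `∫ u n dμ_t` and the transport term is the same number `∫ u
n (·, 0) dν` for both solutions. Only these differences pass to the limit, so nothing is needed
about the convergence of the initial terms. -/
theorem ae_integral_eq_of_tendsto (hT : 0 ≤ T)
    {b : EuclideanSpace ℝ (Fin d) → EuclideanSpace ℝ (Fin d)} (hb : Measurable b)
    {ν : LocallyBoundedMeasure (EuclideanSpace ℝ (Fin d))}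
    {μ₁ μ₂ : LocallyBoundedMeasure (EuclideanSpace ℝ (Fin d) × Icc (0 : ℝ) T)}
    {μt₁ μt₂ : ℝ → LocallyBoundedMeasure (EuclideanSpace ℝ (Fin d))}
    (h₁ : IsCauchySolution (fun x _ => b x) ν μ₁ μt₁)
    (h₂ : IsCauchySolution (fun x _ => b x) ν μ₂ μt₂)
    {N : Set (EuclideanSpace ℝ (Fin d))} (hN : MeasurableSet N)
    (hN₁ : ∀ᵐ t ∂volume.restrict (Icc 0 T), (μt₁ t).variation N = 0)
    (hN₂ : ∀ᵐ t ∂volume.restrict (Icc 0 T), (μt₂ t).variation N = 0)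
    {u f : ℕ → EuclideanSpace ℝ (Fin d) → ℝ → ℝ} {v : EuclideanSpace ℝ (Fin d) → ℝ → ℝ} {R C : ℝ}
    (hu : ∀ n, ContDiff ℝ 1 (Function.uncurry (u n)))
    (huR : ∀ n x, ∀ t ∈ Icc 0 T, R < ‖x‖ → u n x t = 0)
    (huC : ∀ n x, ∀ t ∈ Icc 0 T, |u n x t| ≤ C)
    (huv : ∀ x ∉ N, ∀ t ∈ Icc 0 T, Tendsto (fun n => u n x t) atTop (𝓝 (v x t)))
    (hf : ∀ n x, ∀ t ∈ Ioo 0 T,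
      HasDerivAt (fun ε : ℝ => u n (x + ε • b x) (t + ε)) (f n x t) 0)
    (hfC : ∀ n x, ∀ t ∈ Ioo 0 T, |f n x t| ≤ C)
    (hf0 : ∀ x ∉ N, ∀ t ∈ Ioo 0 T, Tendsto (fun n => f n x t) atTop (𝓝 0)) :
    ∀ᵐ t ∂volume.restrict (Icc 0 T),
      (μt₁ t).integral (fun x => v x t) = (μt₂ t).integral (fun x => v x t) := by
  have hC : 0 ≤ C := (abs_nonneg _).trans (huC 0 0 0 (left_mem_Icc.2 hT))
  have hff : ∀ n x, ∀ t ∈ Ioo 0 T,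
      fderiv ℝ (Function.uncurry (u n)) (x, t) (b x, 1) = f n x t := fun n x t ht =>
    (hasDerivAt_along (hu n) x (b x) t).unique (hf n x t ht)
  have hfC' : ∀ n x, ∀ t ∈ Ioo 0 T,
      |fderiv ℝ (Function.uncurry (u n)) (x, t) (b x, 1)| ≤ C := fun n x t ht => by
    rw [hff n x t ht]
    exact hfC n x t ht
  have hsupp : ∀ n x, ∀ t ∈ Ioo 0 T, R < ‖x‖ →
      fderiv ℝ (Function.uncurry (u n)) (x, t) (b x, 1) = 0 := fun n x t ht hx =>
    fderiv_eq_zero_of_vanishes (huR n) ht hx _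
  set g : ℕ → ℝ → EuclideanSpace ℝ (Fin d) × Icc (0 : ℝ) T → ℝ := fun n t p =>
    (Ioo 0 t).indicator
      (fun s => fderiv ℝ (Function.uncurry (u n)) (p.1, s) (b p.1, 1)) p.2 with hg
  have hlim : ∀ {μ : LocallyBoundedMeasure (EuclideanSpace ℝ (Fin d) × Icc (0 : ℝ) T)}
      {μt : ℝ → LocallyBoundedMeasure (EuclideanSpace ℝ (Fin d))}, IsGivenByFamily μ μt →
      (∀ᵐ t ∂volume.restrict (Icc 0 T), (μt t).variation N = 0) → ∀ t ∈ Icc 0 T,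
      Tendsto (fun n => μ.integral (g n t)) atTop (𝓝 0) := by
    intro μ μt hμ hNμ t ht
    have hIoo : ∀ s ∈ Ioo 0 t, s ∈ Ioo 0 T := fun s hs => ⟨hs.1, hs.2.trans_le ht.2⟩
    have h0 : μ.integral (fun _ => 0) = 0 := by simp [LocallyBoundedMeasure.integral]
    suffices Tendsto (fun n => μ.integral (g n t)) atTop (𝓝 (μ.integral fun _ => 0)) by
      rwa [h0] at this
    refine μ.tendsto_integral (N := N ×ˢ univ) (K := Metric.closedBall 0 R ×ˢ univ) (C := C)
      (hN.prod MeasurableSet.univ) (fun A hA hAN hAb => hμ.apply_eq_zero hT hNμ hA hAN hAb) ?_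
      ((isCompact_closedBall 0 R).prod isCompact_univ) ?_ ?_ ?_
    · intro n
      have : g n t = ((fun p : EuclideanSpace ℝ (Fin d) × Icc (0 : ℝ) T => (p.2 : ℝ)) ⁻¹'
          Ioo 0 t).indicator
          fun p => fderiv ℝ (Function.uncurry (u n)) (p.1, (p.2 : ℝ)) (b p.1, 1) := by
        funext p
        rfl
      rw [this]
      exact ((measurable_fderiv_apply (hu n) hb).comp
        (measurable_fst.prodMk (measurable_subtype_coe.comp measurable_snd))).indicator
        ((measurable_subtype_coe.comp measurable_snd) measurableSet_Ioo)
    · rintro n ⟨x, s⟩ hx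
      by_cases hs : (s : ℝ) ∈ Ioo 0 t
      · have hx' : R < ‖x‖ := by
          by_contra hc
          exact hx ⟨mem_closedBall_zero_iff.2 (not_lt.1 hc), mem_univ _⟩
        simp only [hg, indicator_of_mem hs]
        exact hsupp n x s (hIoo s hs) hx'
      · simp only [hg, indicator_of_notMem hs]
    · rintro n ⟨x, s⟩
      by_cases hs : (s : ℝ) ∈ Ioo 0 t
      · simp only [hg, indicator_of_mem hs]
        exact hfC' n x s (hIoo s hs)
      · simpa only [hg, indicator_of_notMem hs, abs_zero] using hC
    · rintro ⟨x, s⟩ hx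
      by_cases hs : (s : ℝ) ∈ Ioo 0 t
      · simp only [hg, indicator_of_mem hs, hff _ x s (hIoo s hs)]
        exact hf0 x (fun hxN => hx ⟨hxN, mem_univ _⟩) s (hIoo s hs)
      · simp only [hg, indicator_of_notMem hs]
        exact tendsto_const_nhds
  have hmain : ∀ {μt : ℝ → LocallyBoundedMeasure (EuclideanSpace ℝ (Fin d))} {t : ℝ},
      (μt t).variation N = 0 → t ∈ Icc 0 T →
      Tendsto (fun n => (μt t).integral (fun x => u n x t)) atTop
        (𝓝 ((μt t).integral fun x => v x t)) := by
    intro μt t hNt ht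
    refine (μt t).tendsto_integral (N := N) (K := Metric.closedBall 0 R) (C := C) hN
      (fun A hA hAN hAb => (μt t).apply_eq_zero_of_variation hNt hA hAb hAN)
      (fun n => ?_) (isCompact_closedBall 0 R) (fun n x hx => ?_) (fun n x => huC n x t ht)
      (fun x hx => huv x hx t ht)
    · exact ((hu n).continuous.comp (Continuous.prodMk_left t)).measurable
    · refine huR n x t ht ?_
      by_contra hc
      exact hx (mem_closedBall_zero_iff.2 (not_lt.1 hc))
  -- The exceptional set of times depends on the test function; a sequence costs only a countable
  -- union.
  have e₁ := ae_all_iff.2 fun n => h₁.equation_of_contDiff hT hb (hu n) hC (huR n) (hfC' n)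
  have e₂ := ae_all_iff.2 fun n => h₂.equation_of_contDiff hT hb (hu n) hC (huR n) (hfC' n)
  filter_upwards [e₁, e₂, hN₁, hN₂, ae_restrict_mem measurableSet_Icc] with t h1 h2 n1 n2 ht
  have l1 := (hmain n1 ht).sub (hlim h₁.isGivenByFamily hN₁ t ht)
  have l2 := (hmain n2 ht).sub (hlim h₂.isGivenByFamily hN₂ t ht)
  have e : ∀ n, (μt₁ t).integral (fun x => u n x t) - μ₁.integral (g n t) =
      (μt₂ t).integral (fun x => u n x t) - μ₂.integral (g n t) := fun n => by
    rw [h1 n, h2 n]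
    simp only [hg]
    ring
  simp only [e, sub_zero] at l1 l2
  exact tendsto_nhds_unique l1 l2

/-- If the integrals of `1_A ψ ∘ F_t` with respect to two families agree for almost all `t`, for
every `ψ` of class `C¹` with compact support in `O`, then the families agree on the Borel subsets
of `A`. -/
theorem ae_eq_of_integral_eq
    {μt₁ μt₂ : ℝ → LocallyBoundedMeasure (EuclideanSpace ℝ (Fin d))}
    {A O : Set (EuclideanSpace ℝ (Fin d))} (hA : MeasurableSet A) (hO : IsOpen O)
    {F : ℝ → EuclideanSpace ℝ (Fin d) → EuclideanSpace ℝ (Fin d)}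
    (hF : ∀ t, Measurable (F t)) (hinj : ∀ t, InjOn (F t) A) (hmaps : ∀ t, MapsTo (F t) A O)
    (hbdd : ∀ M : ℝ, ∃ R : ℝ, ∀ t ∈ Icc 0 T, ∀ x ∈ A, ‖F t x‖ ≤ M → ‖x‖ ≤ R)
    (h : ∀ ψ : EuclideanSpace ℝ (Fin d) → ℝ, ContDiff ℝ 1 ψ → HasCompactSupport ψ →
      Function.support ψ ⊆ O → (∀ x, 0 ≤ ψ x ∧ ψ x ≤ 1) →
      ∀ᵐ t ∂volume.restrict (Icc 0 T),
      (μt₁ t).integral (A.indicator fun x => ψ (F t x)) =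
        (μt₂ t).integral (A.indicator fun x => ψ (F t x))) :
    ∀ᵐ t ∂volume.restrict (Icc 0 T), ∀ B ⊆ A, MeasurableSet B → Bornology.IsBounded B →
      μt₁ t B = μt₂ t B := by
  obtain ⟨𝒞, h𝒞c, h𝒞o, h𝒞u, h𝒞pi, h𝒞⟩ :=
    exists_countable_piSystem_of_isOpen (EuclideanSpace ℝ (Fin d))
  have hind : ∀ V, IsOpen V → Bornology.IsBounded V → V ⊆ O →
      ∀ᵐ t ∂volume.restrict (Icc 0 T), μt₁ t (A ∩ F t ⁻¹' V) = μt₂ t (A ∩ F t ⁻¹' V) := by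
    intro V hV hVb hVO
    obtain ⟨ψ, hψ, hψV, hψ01, hψlim⟩ := exists_seq_contDiff_tendsto_indicator hV
    have hsupp : ∀ k, HasCompactSupport (ψ k) := fun k =>
      hVb.isCompact_closure.of_isClosed_subset (isClosed_tsupport _)
        (closure_mono (hψV k))
    obtain ⟨M, hM⟩ := hVb.subset_closedBall 0
    obtain ⟨R, hR⟩ := hbdd M
    have e := ae_all_iff.2 fun k => h (ψ k) (hψ k) (hsupp k) ((hψV k).trans hVO) (hψ01 k)
    filter_upwards [e, ae_restrict_mem measurableSet_Icc] with t ht htT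
    have hWm : MeasurableSet (A ∩ F t ⁻¹' V) := hA.inter (hF t hV.measurableSet)
    have hWR : A ∩ F t ⁻¹' V ⊆ Metric.closedBall 0 R := fun x hx =>
      mem_closedBall_zero_iff.2 (hR t htT x hx.1 (mem_closedBall_zero_iff.1 (hM hx.2)))
    have hlim : ∀ m : LocallyBoundedMeasure (EuclideanSpace ℝ (Fin d)),
        Tendsto (fun k => m.integral (A.indicator fun x => ψ k (F t x))) atTop
          (𝓝 (m (A ∩ F t ⁻¹' V))) := by
      intro m
      rw [← m.integral_indicator_one hWm (Metric.isBounded_closedBall.subset hWR)]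
      refine m.tendsto_integral (N := ∅) (K := Metric.closedBall 0 R) (C := 1) MeasurableSet.empty
        (fun B _ hB _ => by rw [subset_empty_iff.1 hB, m.apply_empty])
        (fun k => (((hψ k).continuous.measurable.comp (hF t)).indicator hA))
        (isCompact_closedBall 0 R) (fun k x hx => ?_) (fun k x => ?_) (fun x _ => ?_)
      · by_cases hxA : x ∈ A
        · rw [indicator_of_mem hxA]
          by_contra hne
          exact hx (hWR ⟨hxA, hψV k hne⟩)
        · exact indicator_of_notMem hxA _
      · by_cases hxA : x ∈ A
        · rw [indicator_of_mem hxA, abs_of_nonneg (hψ01 k _).1]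
          exact (hψ01 k _).2
        · rw [indicator_of_notMem hxA, abs_zero]
          exact zero_le_one
      · by_cases hxA : x ∈ A
        · simp only [indicator_of_mem hxA]
          convert hψlim (F t x) using 2
          by_cases hxV : F t x ∈ V <;> simp [hxA, hxV]
        · simp [hxA]
    have l1 := hlim (μt₁ t)
    simp only [ht] at l1
    exact tendsto_nhds_unique l1 (hlim (μt₂ t))
  have hall : ∀ᵐ t ∂volume.restrict (Icc 0 T), ∀ k : ℕ, ∀ U ∈ 𝒞,
      μt₁ t (A ∩ F t ⁻¹' (O ∩ Metric.ball 0 k ∩ U)) =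
        μt₂ t (A ∩ F t ⁻¹' (O ∩ Metric.ball 0 k ∩ U)) :=
    ae_all_iff.2 fun k => (ae_ball_iff h𝒞c).2 fun U hU =>
      hind _ ((hO.inter Metric.isOpen_ball).inter (h𝒞o U hU))
        (Metric.isBounded_ball.subset (inter_subset_left.trans inter_subset_right))
        (inter_subset_left.trans inter_subset_left)
  filter_upwards [hall, ae_restrict_mem measurableSet_Icc] with t ht htT B hBA hB hBb
  -- Lusin–Souslin: injective Borel images are Borel. Hence `B = A ∩ F t ⁻¹' (F t '' B)`, and it
  -- suffices to treat preimages.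
  have hVm : MeasurableSet (F t '' B) :=
    hB.image_of_measurable_injOn (hF t) ((hinj t).mono hBA)
  have hstep : ∀ (k : ℕ) (V : Set (EuclideanSpace ℝ (Fin d))), MeasurableSet V →
      μt₁ t (A ∩ F t ⁻¹' (O ∩ Metric.ball 0 k) ∩ F t ⁻¹' V) =
        μt₂ t (A ∩ F t ⁻¹' (O ∩ Metric.ball 0 k) ∩ F t ⁻¹' V) := by
    intro k V hV
    have hb : Bornology.IsBounded (A ∩ F t ⁻¹' (O ∩ Metric.ball 0 k)) := by
      obtain ⟨R, hR⟩ := hbdd k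
      refine Metric.isBounded_closedBall (x := 0) (r := R) |>.subset fun x hx => ?_
      exact mem_closedBall_zero_iff.2 (hR t htT x hx.1 (mem_ball_zero_iff.1 hx.2.2).le)
    refine LocallyBoundedMeasure.apply_inter_preimage_eq h𝒞 h𝒞pi (hF t)
      (hA.inter (hF t (hO.inter Metric.isOpen_ball).measurableSet)) hb ?_ (fun U hU => ?_) hV
    · simpa using ht k univ h𝒞u
    · rw [inter_assoc, ← preimage_inter]
      exact ht k U hU
  -- The π-λ argument is confined to preimages of balls, since `A` itself may be unbounded; the
  -- pieces `⌊‖y‖⌋₊ = k` of the image reassemble `B`.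
  set D : ℕ → Set (EuclideanSpace ℝ (Fin d)) := fun k => {y | ⌊‖y‖⌋₊ = k} with hD
  have hDm : ∀ k, MeasurableSet (D k) := fun k =>
    (Nat.measurable_floor.comp measurable_norm) (measurableSet_singleton k)
  have hBD : ∀ k, B ∩ F t ⁻¹' D k =
      A ∩ F t ⁻¹' (O ∩ Metric.ball 0 (k + 1 : ℕ)) ∩ F t ⁻¹' (F t '' B ∩ D k) := by
    intro k
    ext x
    constructor
    · rintro ⟨hxB, hxD⟩
      refine ⟨⟨hBA hxB, hmaps t (hBA hxB), ?_⟩, mem_image_of_mem _ hxB, hxD⟩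
      rw [mem_ball_zero_iff, ← show ⌊‖F t x‖⌋₊ = k from hxD]
      push_cast
      exact Nat.lt_floor_add_one _
    · rintro ⟨⟨hxA, -⟩, ⟨y, hyB, hyx⟩, hxD⟩
      rw [← hinj t (hBA hyB) hxA hyx] at hxD ⊢
      exact ⟨hyB, hxD⟩
  have hU : ⋃ k, B ∩ F t ⁻¹' D k = B := by
    ext x
    simp [hD]
  have hs : ∀ m : LocallyBoundedMeasure (EuclideanSpace ℝ (Fin d)),
      HasSum (fun k => m (B ∩ F t ⁻¹' D k)) (m B) := by
    intro m
    have := m.hasSum_iUnion (fun k => B ∩ F t ⁻¹' D k) (fun k => hB.inter (hF t (hDm k)))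
      (by rwa [hU]) (fun i j hij => by
        refine Set.disjoint_left.2 fun x hx hx' => hij ?_
        exact hx.2.symm.trans hx'.2)
    rwa [hU] at this
  have h1 := hs (μt₁ t)
  have e : ∀ k, μt₁ t (B ∩ F t ⁻¹' D k) = μt₂ t (B ∩ F t ⁻¹' D k) := fun k => by
    rw [hBD k]
    exact hstep _ _ (hVm.inter (hDm k))
  simp only [e] at h1
  exact h1.unique (hs (μt₂ t))

end

/-! ### Radial cutoffs and the one-sided Lipschitz condition -/

section

/-- A smooth step, equal to `0` on `(-∞, a + ε]` and to `1` on `[a + 2ε, ∞)`. -/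
noncomputable def smoothStep (a ε s : ℝ) : ℝ := Real.smoothTransition ((s - a) / ε - 1)

theorem smoothStep_mem (a ε s : ℝ) : 0 ≤ smoothStep a ε s ∧ smoothStep a ε s ≤ 1 :=
  ⟨Real.smoothTransition.nonneg _, Real.smoothTransition.le_one _⟩

theorem contDiff_smoothStep (a ε : ℝ) : ContDiff ℝ 1 (smoothStep a ε) :=
  Real.smoothTransition.contDiff.comp
    (((contDiff_id.sub contDiff_const).div_const ε).sub contDiff_const)

theorem smoothStep_eq_zero {a ε s : ℝ} (hε : 0 < ε) (hs : s ≤ a + ε) : smoothStep a ε s = 0 := by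
  refine Real.smoothTransition.zero_of_nonpos ?_
  rw [sub_nonpos, div_le_one hε]
  linarith

theorem smoothStep_eq_one {a ε s : ℝ} (hε : 0 < ε) (hs : a + 2 * ε ≤ s) :
    smoothStep a ε s = 1 := by
  refine Real.smoothTransition.one_of_one_le ?_
  have : 2 ≤ (s - a) / ε := by
    rw [le_div_iff₀ hε]
    linarith
  linarith

/-- `0` and `1` are the extreme values of the step, so any point where they are attained is
critical. -/
theorem deriv_smoothStep_eq_zero {a ε s : ℝ} (h : smoothStep a ε s = 0 ∨ smoothStep a ε s = 1) :
    deriv (smoothStep a ε) s = 0 := by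
  rcases h with h | h
  · refine IsLocalMin.deriv_eq_zero (Filter.Eventually.of_forall fun r => ?_)
    simpa only [h] using (smoothStep_mem a ε r).1
  · refine IsLocalMax.deriv_eq_zero (Filter.Eventually.of_forall fun r => ?_)
    simpa only [h] using (smoothStep_mem a ε r).2

theorem exists_abs_deriv_smoothStep_le :
    ∃ L : ℝ, 0 ≤ L ∧ ∀ a ε s : ℝ, 0 < ε → |deriv (smoothStep a ε) s| ≤ L / ε := by
  have hc : Continuous (deriv Real.smoothTransition) :=
    (Real.smoothTransition.contDiff (n := 1)).continuous_deriv le_rfl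
  obtain ⟨L, hL⟩ := isCompact_Icc (a := (0 : ℝ)) (b := 1) |>.exists_bound_of_continuousOn
    hc.continuousOn
  have hL0 : 0 ≤ L := (norm_nonneg _).trans (hL 0 (by simp))
  have hb : ∀ x, |deriv Real.smoothTransition x| ≤ L := by
    intro x
    by_cases hx : x ∈ Icc (0 : ℝ) 1
    · exact hL x hx
    · have : deriv Real.smoothTransition x = 0 := by
        rw [mem_Icc, not_and_or, not_le, not_le] at hx
        rcases hx with hx | hx
        · refine IsLocalMin.deriv_eq_zero (Filter.Eventually.of_forall fun r => ?_)
          rw [Real.smoothTransition.zero_of_nonpos hx.le]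
          exact Real.smoothTransition.nonneg r
        · refine IsLocalMax.deriv_eq_zero (Filter.Eventually.of_forall fun r => ?_)
          rw [Real.smoothTransition.one_of_one_le hx.le]
          exact Real.smoothTransition.le_one r
      rw [this, abs_zero]
      exact hL0
  refine ⟨L, hL0, fun a ε s hε => ?_⟩
  have h1 : HasDerivAt (fun s : ℝ => (s - a) / ε - 1) (1 / ε) s :=
    (((hasDerivAt_id s).sub_const a).div_const ε).sub_const 1
  have h2 := ((Real.smoothTransition.contDiff (n := 1)).differentiable one_ne_zero
    ((s - a) / ε - 1)).hasDerivAt.comp s h1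
  have h3 : deriv (smoothStep a ε) s = deriv Real.smoothTransition ((s - a) / ε - 1) * (1 / ε) :=
    h2.deriv
  rw [h3, abs_mul, abs_of_pos (one_div_pos.2 hε), mul_one_div]
  exact div_le_div_of_nonneg_right (hb _) hε.le

theorem smoothStep_of_le {a s : ℝ} (hs : s ≤ a) {ε : ℝ} (hε : 0 < ε) :
    smoothStep a ε s = 0 ∧ deriv (smoothStep a ε) s = 0 := by
  have := smoothStep_eq_zero (a := a) (s := s) hε (by linarith)
  exact ⟨this, deriv_smoothStep_eq_zero (Or.inl this)⟩

theorem eventually_smoothStep_of_lt {a s : ℝ} (hs : a < s) :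
    ∀ᶠ n : ℕ in atTop, smoothStep a (1 / ((n : ℝ) + 1)) s = 1 ∧
      deriv (smoothStep a (1 / ((n : ℝ) + 1))) s = 0 := by
  have h : ∀ᶠ n : ℕ in atTop, 1 / ((n : ℝ) + 1) < (s - a) / 2 :=
    tendsto_one_div_add_atTop_nhds_zero_nat.eventually (gt_mem_nhds (by linarith))
  filter_upwards [h] with n hn
  have := smoothStep_eq_one (a := a) (s := s) (ε := 1 / ((n : ℝ) + 1)) (by positivity)
    (by linarith)
  exact ⟨this, deriv_smoothStep_eq_zero (Or.inr this)⟩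

variable {β : ℝ → ℝ}

/-- The derivative is of order `1 / ε` and lives on `a + ε < s < a + 2ε`, so `s β(s) = O(ε)` is
needed there. If `a = 0`, the factor `s` provides it; if `β a = 0`, monotonicity of `β s - Λ s`
gives `β s ≤ Λ (s - a) ≤ 2Λε`. -/
theorem exists_abs_mul_deriv_smoothStep_le (hβ_nonneg : ∀ s, 0 ≤ s → 0 ≤ β s)
    (hβ_bdd : ∃ C, ∀ s, 0 ≤ s → β s ≤ C)
    (hβ_decr : ∀ N : ℝ, 0 < N → ∃ Λ : ℝ, 0 < Λ ∧ AntitoneOn (fun s => β s - Λ * s) (Icc 0 N))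
    {a : ℝ} (ha : 0 ≤ a) (ha' : a = 0 ∨ β a = 0) :
    ∃ K, ∀ ε s : ℝ, 0 < ε → ε ≤ 1 → 0 ≤ s → |s * β s * deriv (smoothStep a ε) s| ≤ K := by
  obtain ⟨L, hL0, hL⟩ := exists_abs_deriv_smoothStep_le
  obtain ⟨C, hC⟩ := hβ_bdd
  -- `[0, a + 2]` contains the whole transition zone, since `ε ≤ 1`.
  obtain ⟨Λ, hΛ, hanti⟩ := hβ_decr (a + 2) (by linarith)
  have hC0 : 0 ≤ C := (hβ_nonneg 0 le_rfl).trans (hC 0 le_rfl)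
  refine ⟨max (2 * C * L) ((a + 2) * (2 * Λ) * L), fun ε s hε hε1 hs => ?_⟩
  have hK : 0 ≤ max (2 * C * L) ((a + 2) * (2 * Λ) * L) := le_max_of_le_left (by positivity)
  by_cases h1 : s ≤ a + ε
  · rw [deriv_smoothStep_eq_zero (Or.inl (smoothStep_eq_zero hε h1)), mul_zero, abs_zero]
    exact hK
  by_cases h2 : a + 2 * ε ≤ s
  · rw [deriv_smoothStep_eq_zero (Or.inr (smoothStep_eq_one hε h2)), mul_zero, abs_zero]
    exact hK
  rw [not_le] at h1 h2
  have hβs := hβ_nonneg s hs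
  have key : ∀ M, s * β s ≤ M * ε → |s * β s * deriv (smoothStep a ε) s| ≤ M * L := by
    intro M hM
    rw [abs_mul, abs_of_nonneg (by positivity)]
    calc s * β s * |deriv (smoothStep a ε) s| ≤ M * ε * (L / ε) :=
          mul_le_mul hM (hL a ε s hε) (abs_nonneg _) ((by positivity : 0 ≤ s * β s).trans hM)
      _ = M * L := by field_simp
  rcases ha' with ha' | ha'
  · refine (key (2 * C) ?_).trans (le_max_left _ _)
    have : s ≤ 2 * ε := by linarith
    calc s * β s ≤ 2 * ε * C := mul_le_mul this (hC s hs) hβs (by positivity)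
      _ = 2 * C * ε := by ring
  · refine (key ((a + 2) * (2 * Λ)) ?_).trans (le_max_right _ _)
    have h3 := hanti (⟨ha, by linarith⟩ : a ∈ Icc 0 (a + 2))
      (⟨hs, by linarith⟩ : s ∈ Icc 0 (a + 2)) (by linarith)
    simp only [ha'] at h3
    have h4 : β s ≤ 2 * Λ * ε := by nlinarith
    calc s * β s ≤ (a + 2) * (2 * Λ * ε) :=
          mul_le_mul (by linarith) h4 hβs (by linarith)
      _ = (a + 2) * (2 * Λ) * ε := by ring

theorem exists_lower_zero (hβ_nonneg : ∀ s, 0 ≤ s → 0 ≤ β s)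
    (hβ_cont : ContinuousOn β (Ici 0)) {σ : ℝ} (hσ : 0 < σ) (hβσ : 0 < β σ) :
    ∃ a, 0 ≤ a ∧ a < σ ∧ (a = 0 ∨ β a = 0) ∧ ∀ s ∈ Ioc a σ, 0 < β s := by
  -- The endpoint `a` is the last zero of `β` before `σ`, or `0` if there is none; adding `0` to the
  -- set covers both cases.
  have hK : IsCompact ({0} ∪ (Icc 0 σ ∩ β ⁻¹' {0})) :=
    isCompact_singleton.union (isCompact_Icc.of_isClosed_subset
      ((hβ_cont.mono Icc_subset_Ici_self).preimage_isClosed_of_isClosed isClosed_Icc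
        isClosed_singleton) inter_subset_left)
  obtain ⟨a, ha, hmax⟩ := hK.exists_isGreatest ⟨0, Or.inl rfl⟩
  have ha0 : 0 ≤ a := hmax (Or.inl rfl)
  have ha' : a = 0 ∨ β a = 0 := ha.imp id fun h => h.2
  have haσ : a < σ := by
    rcases ha with h | h
    · rwa [mem_singleton_iff.1 h]
    · refine lt_of_le_of_ne h.1.2 fun e => ?_
      have : β a = 0 := h.2
      rw [e] at this
      exact hβσ.ne' this
  refine ⟨a, ha0, haσ, ha', fun s hs => ?_⟩
  refine lt_of_le_of_ne (hβ_nonneg s (ha0.trans hs.1.le)) fun h => ?_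
  exact (hmax (Or.inr ⟨⟨ha0.trans hs.1.le, hs.2⟩, h.symm⟩)).not_gt hs.1

theorem exists_upper_zero (hβ_nonneg : ∀ s, 0 ≤ s → 0 ≤ β s)
    (hβ_cont : ContinuousOn β (Ici 0)) {σ : ℝ} (hσ : 0 < σ) (hβσ : 0 < β σ) :
    (∀ s ∈ Ici σ, 0 < β s) ∨ ∃ c, σ < c ∧ β c = 0 ∧ ∀ s ∈ Ico σ c, 0 < β s := by
  by_cases h : ∀ s ∈ Ici σ, 0 < β s
  · exact Or.inl h
  right
  push Not at h
  obtain ⟨r, hr, hβr⟩ := h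
  have hr0 : β r = 0 := le_antisymm hβr (hβ_nonneg r (hσ.le.trans hr))
  have hK : IsCompact (Icc σ r ∩ β ⁻¹' {0}) :=
    isCompact_Icc.of_isClosed_subset
      ((hβ_cont.mono fun s hs => hσ.le.trans hs.1).preimage_isClosed_of_isClosed isClosed_Icc
        isClosed_singleton) inter_subset_left
  obtain ⟨c, hc, hmin⟩ := hK.exists_isLeast ⟨r, ⟨hr, le_rfl⟩, hr0⟩
  have hβc : β c = 0 := hc.2
  refine ⟨c, lt_of_le_of_ne hc.1.1 fun e => ?_, hβc, fun s hs => ?_⟩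
  · rw [← e] at hβc
    exact hβσ.ne' hβc
  · refine lt_of_le_of_ne (hβ_nonneg s (hσ.le.trans hs.1)) fun h => ?_
    exact (hmin ⟨⟨hs.1, hs.2.le.trans hc.1.2⟩, h.symm⟩).not_gt hs.2

/-- Cutoff functions adapted to the connected component of `{s > 0 | β s > 0}` that contains
`σ`. -/
theorem exists_component_cutoff (hβ_nonneg : ∀ s, 0 ≤ s → 0 ≤ β s)
    (hβ_bdd : ∃ C, ∀ s, 0 ≤ s → β s ≤ C) (hβ_cont : ContinuousOn β (Ici 0))
    (hβ_decr : ∀ N : ℝ, 0 < N → ∃ Λ : ℝ, 0 < Λ ∧ AntitoneOn (fun s => β s - Λ * s) (Icc 0 N))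
    {σ : ℝ} (hσ : 0 < σ) (hβσ : 0 < β σ) :
    ∃ (J : Set ℝ) (w : ℕ → ℝ → ℝ) (K : ℝ), σ ∈ J ∧ IsOpen J ∧ J.OrdConnected ∧
      (∀ s ∈ J, 0 < s ∧ 0 < β s) ∧ (∀ n, ContDiff ℝ 1 (w n)) ∧
      (∀ n s, 0 ≤ w n s ∧ w n s ≤ 1) ∧ (∀ n, ∃ ε > 0, ∀ s < ε, w n s = 0) ∧
      (∀ n s, 0 ≤ s → |s * β s * deriv (w n) s| ≤ K) ∧
      (∀ s ∈ J, ∀ᶠ n in atTop, w n s = 1 ∧ deriv (w n) s = 0) ∧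
      (∀ s ∉ J, (∀ᶠ n in atTop, w n s = 0 ∧ deriv (w n) s = 0) ∨
        (0 < s ∧ β s = 0 ∧ s ∈ closure J)) := by
  obtain ⟨a, ha0, haσ, ha, hapos⟩ := exists_lower_zero hβ_nonneg hβ_cont hσ hβσ
  obtain ⟨K, hK⟩ := exists_abs_mul_deriv_smoothStep_le hβ_nonneg hβ_bdd hβ_decr ha0 ha
  have hε : ∀ n : ℕ, 0 < 1 / ((n : ℝ) + 1) := fun n => by positivity
  have hε1 : ∀ n : ℕ, 1 / ((n : ℝ) + 1) ≤ 1 := fun n => by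
    rw [div_le_one (by positivity)]
    simp
  have hlow : ∀ n : ℕ, ∃ ε > 0, ∀ s < ε, smoothStep a (1 / ((n : ℝ) + 1)) s = 0 := fun n =>
    ⟨1 / ((n : ℝ) + 1), hε n, fun s hs => smoothStep_eq_zero (hε n) (by linarith)⟩
  rcases exists_upper_zero hβ_nonneg hβ_cont hσ hβσ with hup | ⟨c, hσc, hβc, hcpos⟩
  · refine ⟨Ioi a, fun n => smoothStep a (1 / ((n : ℝ) + 1)), K, haσ, isOpen_Ioi, ordConnected_Ioi,
      fun s hs => ⟨ha0.trans_lt hs, ?_⟩, fun n => contDiff_smoothStep _ _,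
      fun n s => smoothStep_mem _ _ _, hlow, fun n s hs => hK _ _ (hε n) (hε1 n) hs,
      fun s hs => eventually_smoothStep_of_lt hs, fun s hs => Or.inl ?_⟩
    · rcases le_total s σ with h | h
      · exact hapos s ⟨hs, h⟩
      · exact hup s h
    · exact Eventually.of_forall fun n => smoothStep_of_le (not_lt.1 hs) (hε n)
  · obtain ⟨K', hK'⟩ := exists_abs_mul_deriv_smoothStep_le hβ_nonneg hβ_bdd hβ_decr
      (hσ.le.trans hσc.le) (Or.inr hβc)
    have hd : ∀ (n : ℕ) (s : ℝ), deriv (fun s => smoothStep a (1 / ((n : ℝ) + 1)) s *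
        (1 - smoothStep c (1 / ((n : ℝ) + 1)) s)) s =
        deriv (smoothStep a (1 / ((n : ℝ) + 1))) s * (1 - smoothStep c (1 / ((n : ℝ) + 1)) s) -
        smoothStep a (1 / ((n : ℝ) + 1)) s * deriv (smoothStep c (1 / ((n : ℝ) + 1))) s := by
      intro n s
      have h1 := ((contDiff_smoothStep a (1 / ((n : ℝ) + 1))).differentiable one_ne_zero
        s).hasDerivAt
      have h2 := ((contDiff_smoothStep c (1 / ((n : ℝ) + 1))).differentiable one_ne_zero
        s).hasDerivAt
      have h3 := (h1.mul (h2.const_sub 1)).deriv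
      refine Eq.trans ?_ (h3.trans (by ring))
      rfl
    have hac : a < c := haσ.trans hσc
    -- The descent starts at `c + ε`, not before `c`, because `β` is controlled by the distance to
    -- `c` only on the right. So the cutoff tends to `1` at `c`, the single point that falls under
    -- the second alternative of the last clause.
    refine ⟨Ioo a c, fun n s => smoothStep a (1 / ((n : ℝ) + 1)) s *
      (1 - smoothStep c (1 / ((n : ℝ) + 1)) s), K + K', ⟨haσ, hσc⟩, isOpen_Ioo, ordConnected_Ioo,
      fun s hs => ⟨ha0.trans_lt hs.1, ?_⟩,
      fun n => (contDiff_smoothStep _ _).mul (contDiff_const.sub (contDiff_smoothStep _ _)),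
      fun n s => ?_, fun n => ?_, fun n s hs => ?_, fun s hs => ?_, fun s hs => ?_⟩
    · rcases le_total s σ with h | h
      · exact hapos s ⟨hs.1, h⟩
      · exact hcpos s ⟨h, hs.2⟩
    · have h1 := smoothStep_mem a (1 / ((n : ℝ) + 1)) s
      have h2 := smoothStep_mem c (1 / ((n : ℝ) + 1)) s
      exact ⟨mul_nonneg h1.1 (by linarith), mul_le_one₀ h1.2 (by linarith) (by linarith)⟩
    · obtain ⟨ε, hε0, h⟩ := hlow n
      exact ⟨ε, hε0, fun s hs => by simp only [h s hs, zero_mul]⟩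
    · rw [hd, mul_sub]
      have h1 := smoothStep_mem a (1 / ((n : ℝ) + 1)) s
      have h2 := smoothStep_mem c (1 / ((n : ℝ) + 1)) s
      refine (abs_sub _ _).trans (add_le_add ?_ ?_)
      · rw [← mul_assoc, abs_mul]
        refine (mul_le_of_le_one_right (abs_nonneg _) ?_).trans (hK _ s (hε n) (hε1 n) hs)
        rw [abs_of_nonneg (by linarith)]
        linarith
      · rw [mul_left_comm, abs_mul]
        refine (mul_le_of_le_one_left (abs_nonneg _) ?_).trans (hK' _ s (hε n) (hε1 n) hs)
        rw [abs_of_nonneg h1.1]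
        exact h1.2
    · filter_upwards [eventually_smoothStep_of_lt hs.1] with n hn
      have h2 := smoothStep_of_le hs.2.le (hε n)
      rw [hd, hn.1, hn.2, h2.1, h2.2]
      simp
    · by_cases h1 : s ≤ a
      · refine Or.inl (Eventually.of_forall fun n => ?_)
        have h2 := smoothStep_of_le h1 (hε n)
        refine ⟨by simp only [h2.1, zero_mul], ?_⟩
        rw [hd, h2.1, h2.2]
        simp
      · rw [not_le] at h1
        have h2 : c ≤ s := not_lt.1 fun h => hs ⟨h1, h⟩
        rcases h2.eq_or_lt with h2 | h2
        · refine Or.inr ⟨ha0.trans_lt h1, h2 ▸ hβc, ?_⟩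
          rw [closure_Ioo hac.ne, ← h2]
          exact right_mem_Icc.2 hac.le
        · refine Or.inl ?_
          filter_upwards [eventually_smoothStep_of_lt h1, eventually_smoothStep_of_lt h2]
            with n hn hn'
          rw [hd, hn.1, hn.2, hn'.1, hn'.2]
          simp

end

/-! ### Straightening the radial flow -/

section

variable {β : ℝ → ℝ}

/-- The time that a solution of `s' = -2 max(β(s), δ) s` needs to come from `exp τ` to
`exp τ₀`. -/
noncomputable def travelTime (β : ℝ → ℝ) (δ τ₀ τ : ℝ) : ℝ :=
  ∫ r in τ₀..τ, (2 * max (β (Real.exp r)) δ)⁻¹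

theorem continuous_comp_exp (hβ_cont : ContinuousOn β (Ici 0)) :
    Continuous fun r => β (Real.exp r) :=
  hβ_cont.comp_continuous Real.continuous_exp fun r => (Real.exp_pos r).le

theorem continuous_travelTime_integrand (hβ_cont : ContinuousOn β (Ici 0)) {δ : ℝ} (hδ : 0 < δ) :
    Continuous fun r => (2 * max (β (Real.exp r)) δ)⁻¹ :=
  (continuous_const.mul ((continuous_comp_exp hβ_cont).max continuous_const)).inv₀ fun _ =>
    (mul_pos two_pos (lt_max_of_lt_right hδ)).ne'

theorem hasDerivAt_travelTime (hβ_cont : ContinuousOn β (Ici 0)) {δ : ℝ} (hδ : 0 < δ)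
    (τ₀ τ : ℝ) : HasDerivAt (travelTime β δ τ₀) (2 * max (β (Real.exp τ)) δ)⁻¹ τ :=
  (continuous_travelTime_integrand hβ_cont hδ).integral_hasStrictDerivAt τ₀ τ |>.hasDerivAt

theorem contDiff_travelTime (hβ_cont : ContinuousOn β (Ici 0)) {δ : ℝ} (hδ : 0 < δ) (τ₀ : ℝ) :
    ContDiff ℝ 1 (travelTime β δ τ₀) := by
  rw [contDiff_one_iff_deriv]
  refine ⟨fun τ => (hasDerivAt_travelTime hβ_cont hδ τ₀ τ).differentiableAt, ?_⟩
  have : deriv (travelTime β δ τ₀) = fun r => (2 * max (β (Real.exp r)) δ)⁻¹ :=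
    funext fun τ => (hasDerivAt_travelTime hβ_cont hδ τ₀ τ).deriv
  rw [this]
  exact continuous_travelTime_integrand hβ_cont hδ

theorem strictMono_travelTime (hβ_cont : ContinuousOn β (Ici 0)) {δ : ℝ} (hδ : 0 < δ) (τ₀ : ℝ) :
    StrictMono (travelTime β δ τ₀) :=
  strictMono_of_hasDerivAt_pos (fun τ => hasDerivAt_travelTime hβ_cont hδ τ₀ τ)
    fun _ => inv_pos.2 (mul_pos two_pos (lt_max_of_lt_right hδ))

/-- The speed of `log s` is at most `2C`. This makes the travel time tend to infinity with `|x|`,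
which turns compact support of `ψ` into bounded support of the test function. -/
theorem le_travelTime (hβ_cont : ContinuousOn β (Ici 0)) {C : ℝ} (hC : ∀ s, 0 ≤ s → β s ≤ C)
    {δ τ₀ τ : ℝ} (hδ : 0 < δ) (hδC : δ ≤ C) (hτ : τ₀ ≤ τ) :
    (τ - τ₀) / (2 * C) ≤ travelTime β δ τ₀ τ := by
  have h : ∫ _ in τ₀..τ, (2 * C)⁻¹ ≤ travelTime β δ τ₀ τ := by
    refine intervalIntegral.integral_mono hτ (by simp)
      ((continuous_travelTime_integrand hβ_cont hδ).intervalIntegrable _ _) fun r => ?_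
    refine inv_anti₀ (mul_pos two_pos (lt_max_of_lt_right hδ)) ?_
    exact mul_le_mul_of_nonneg_left (max_le (hC _ (Real.exp_pos r).le) hδC) two_pos.le
  rwa [intervalIntegral.integral_const, smul_eq_mul, ← div_eq_mul_inv] at h

/-- `β ∘ exp` has a positive minimum on the compact interval; below that minimum the regularisation
by `δ` is not felt. -/
theorem exists_travelTime_eq (hβ_cont : ContinuousOn β (Ici 0)) {τ₀ τ : ℝ}
    (h : ∀ r ∈ uIcc τ₀ τ, 0 < β (Real.exp r)) :
    ∃ δ₀ > 0, ∀ δ, 0 ≤ δ → δ ≤ δ₀ → travelTime β δ τ₀ τ = travelTime β 0 τ₀ τ := by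
  obtain ⟨r, hr, hmin⟩ := isCompact_uIcc.exists_isMinOn (nonempty_uIcc (a := τ₀) (b := τ))
    (continuous_comp_exp hβ_cont).continuousOn
  refine ⟨β (Real.exp r), h r hr, fun δ h0 hδ => ?_⟩
  refine intervalIntegral.integral_congr fun q hq => ?_
  have h1 : δ ≤ β (Real.exp q) := hδ.trans (hmin hq)
  simp only [max_eq_left h1, max_eq_left (h0.trans h1)]

variable {d : ℕ}

/-- The map `x ↦ x exp(t + g(log |x|²) - log |x|² / 2)`, where `g` is the travel time. For small
`δ` it is constant along the solutions of `x' = -β(|x|²) x`. -/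
noncomputable def straighten (β : ℝ → ℝ) (δ τ₀ t : ℝ) (x : EuclideanSpace ℝ (Fin d)) :
    EuclideanSpace ℝ (Fin d) :=
  Real.exp (t + travelTime β δ τ₀ (Real.log (‖x‖ ^ 2)) - Real.log (‖x‖ ^ 2) / 2) • x

theorem norm_straighten (δ τ₀ t : ℝ) {x : EuclideanSpace ℝ (Fin d)} (hx : x ≠ 0) :
    ‖straighten β δ τ₀ t x‖ = Real.exp (t + travelTime β δ τ₀ (Real.log (‖x‖ ^ 2))) := by
  have hx' : 0 < ‖x‖ := norm_pos_iff.2 hx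
  rw [straighten, norm_smul, Real.norm_eq_abs, Real.abs_exp, Real.exp_sub, Real.log_pow]
  have : Real.exp ((2 : ℕ) * Real.log ‖x‖ / 2) = ‖x‖ := by
    rw [Nat.cast_ofNat, mul_div_cancel_left₀ _ two_ne_zero, Real.exp_log hx']
  rw [this, div_mul_cancel₀ _ hx'.ne']

theorem straighten_injOn (hβ_cont : ContinuousOn β (Ici 0)) {δ : ℝ} (hδ : 0 < δ) (τ₀ t : ℝ)
    {x y : EuclideanSpace ℝ (Fin d)} (hx : x ≠ 0) (hy : y ≠ 0)
    (h : straighten β δ τ₀ t x = straighten β δ τ₀ t y) : x = y := by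
  have h1 := congrArg norm h
  rw [norm_straighten δ τ₀ t hx, norm_straighten δ τ₀ t hy, Real.exp_eq_exp,
    add_right_inj] at h1
  have h2 := (strictMono_travelTime hβ_cont hδ τ₀).injective h1
  rw [straighten, straighten, h2] at h
  exact (smul_right_inj (Real.exp_pos _).ne').1 h

theorem contDiffAt_straighten (hβ_cont : ContinuousOn β (Ici 0)) {δ : ℝ} (hδ : 0 < δ) (τ₀ : ℝ)
    (p : EuclideanSpace ℝ (Fin d) × ℝ) (hp : p.1 ≠ 0) :
    ContDiffAt ℝ 1 (fun p : EuclideanSpace ℝ (Fin d) × ℝ => straighten β δ τ₀ p.2 p.1) p := by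
  have h1 : ContDiffAt ℝ 1
      (fun p : EuclideanSpace ℝ (Fin d) × ℝ => Real.log (‖p.1‖ ^ 2)) p :=
    (contDiff_fst.norm_sq ℝ).contDiffAt.log (pow_pos (norm_pos_iff.2 hp) 2).ne'
  exact ((contDiffAt_snd.add ((contDiff_travelTime hβ_cont hδ τ₀).contDiffAt.comp p h1)).sub
    (h1.div_const 2)).exp.smul contDiffAt_fst

/-- The test functions used for the uniqueness on a spherical shell. -/
noncomputable def shellTest (β w : ℝ → ℝ) (ψ : EuclideanSpace ℝ (Fin d) → ℝ) (δ τ₀ : ℝ)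
    (x : EuclideanSpace ℝ (Fin d)) (t : ℝ) : ℝ :=
  w (‖x‖ ^ 2) * ψ (straighten β δ τ₀ t x)

/-- The straightening map is singular only at the origin, and there the cutoff vanishes in a
neighbourhood. -/
theorem contDiff_shellTest (hβ_cont : ContinuousOn β (Ici 0)) {w : ℝ → ℝ} (hw : ContDiff ℝ 1 w)
    (hw0 : ∃ ε > 0, ∀ s < ε, w s = 0) {ψ : EuclideanSpace ℝ (Fin d) → ℝ} (hψ : ContDiff ℝ 1 ψ)
    {δ : ℝ} (hδ : 0 < δ) (τ₀ : ℝ) :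
    ContDiff ℝ 1 (Function.uncurry (shellTest β w ψ δ τ₀)) := by
  rw [contDiff_iff_contDiffAt]
  intro p
  by_cases hp : p.1 = 0
  · obtain ⟨ε, hε, hw0⟩ := hw0
    have : Function.uncurry (shellTest β w ψ δ τ₀) =ᶠ[𝓝 p] fun _ => 0 := by
      have hc : Continuous fun q : EuclideanSpace ℝ (Fin d) × ℝ => ‖q.1‖ ^ 2 := by fun_prop
      filter_upwards [hc.continuousAt.eventually (gt_mem_nhds (by simpa [hp] using hε))]
        with q hq
      rw [Function.uncurry, shellTest, hw0 _ hq, zero_mul]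
    exact contDiffAt_const.congr_of_eventuallyEq this
  · exact (hw.contDiffAt.comp p (contDiff_fst.norm_sq ℝ).contDiffAt).mul
      (hψ.contDiffAt.comp p (contDiffAt_straighten hβ_cont hδ τ₀ p hp))

theorem norm_sq_along (x : EuclideanSpace ℝ (Fin d)) (c ε : ℝ) :
    ‖x + ε • -(c • x)‖ ^ 2 = ‖x‖ ^ 2 * (1 - ε * c) ^ 2 := by
  have : x + ε • -(c • x) = (1 - ε * c) • x := by module
  rw [this, norm_smul, mul_pow, Real.norm_eq_abs, sq_abs, mul_comm]

theorem hasDerivAt_norm_sq_along (x : EuclideanSpace ℝ (Fin d)) (c : ℝ) :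
    HasDerivAt (fun ε : ℝ => ‖x + ε • -(c • x)‖ ^ 2) (-2 * c * ‖x‖ ^ 2) 0 := by
  simp only [norm_sq_along]
  have h := ((((hasDerivAt_id (0 : ℝ)).mul_const c).const_sub 1).pow 2).const_mul (‖x‖ ^ 2)
  refine (h.congr_deriv ?_)
  simp
  ring

theorem hasDerivAt_radial_along {w : ℝ → ℝ} (hw : ContDiff ℝ 1 w)
    (x : EuclideanSpace ℝ (Fin d)) (c : ℝ) :
    HasDerivAt (fun ε : ℝ => w (‖x + ε • -(c • x)‖ ^ 2))
      (-2 * (‖x‖ ^ 2 * c * deriv w (‖x‖ ^ 2))) 0 := by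
  have h1 : HasDerivAt w (deriv w (‖x‖ ^ 2)) (‖x + (0 : ℝ) • -(c • x)‖ ^ 2) := by
    simpa using (hw.differentiable one_ne_zero (‖x‖ ^ 2)).hasDerivAt
  refine (h1.comp 0 (hasDerivAt_norm_sq_along x c)).congr_deriv ?_
  ring

/-- With `c = β(|x|²)`, the exponent grows at rate `1 - c / max c δ + c` and the factor `x` shrinks
at rate `c`. What remains is the defect of conservation, zero when `δ ≤ c` and between `0` and `1`
when `c ≥ 0`. -/
theorem hasDerivAt_straighten_along (hβ_cont : ContinuousOn β (Ici 0)) {δ : ℝ} (hδ : 0 < δ)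
    (τ₀ t : ℝ) {x : EuclideanSpace ℝ (Fin d)} (hx : x ≠ 0) :
    HasDerivAt (fun ε : ℝ => straighten β δ τ₀ (t + ε) (x + ε • -(β (‖x‖ ^ 2) • x)))
      ((1 - β (‖x‖ ^ 2) / max (β (‖x‖ ^ 2)) δ) • straighten β δ τ₀ t x) 0 := by
  have hs : 0 < ‖x‖ ^ 2 := pow_pos (norm_pos_iff.2 hx) 2
  set c := β (‖x‖ ^ 2) with hc
  have hl : HasDerivAt (fun ε : ℝ => Real.log (‖x + ε • -(c • x)‖ ^ 2)) (-2 * c) 0 := by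
    refine ((hasDerivAt_norm_sq_along x c).log ?_).congr_deriv ?_
    · simpa using hs.ne'
    · simp only [zero_smul, add_zero]
      field_simp
  have hg : HasDerivAt (travelTime β δ τ₀) (2 * max c δ)⁻¹
      (Real.log (‖x + (0 : ℝ) • -(c • x)‖ ^ 2)) := by
    have := hasDerivAt_travelTime hβ_cont hδ τ₀ (Real.log (‖x‖ ^ 2))
    rw [Real.exp_log hs] at this
    simpa using this
  have hv : HasDerivAt (fun ε : ℝ => x + ε • -(c • x)) (-(c • x)) 0 := by
    simpa using! ((hasDerivAt_id (0 : ℝ)).smul_const (-(c • x))).const_add x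
  have hκ := ((((hasDerivAt_id (0 : ℝ)).const_add t).add (hg.comp 0 hl)).sub
    (hl.div_const 2)).exp
  have h := hκ.smul hv
  have hM : max c δ ≠ 0 := (lt_max_of_lt_right hδ).ne'
  refine h.congr_deriv ?_
  simp only [straighten, zero_smul, add_zero, Pi.add_apply, Pi.sub_apply, Function.comp_apply, id]
  rw [smul_smul, smul_neg, smul_smul, ← neg_smul, ← add_smul]
  congr 1
  field_simp
  ring

theorem hasDerivAt_shellTest_along (hβ_cont : ContinuousOn β (Ici 0)) {w : ℝ → ℝ}
    (hw : ContDiff ℝ 1 w) (hw0 : w 0 = 0) {ψ : EuclideanSpace ℝ (Fin d) → ℝ}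
    (hψ : ContDiff ℝ 1 ψ) {δ : ℝ} (hδ : 0 < δ) (τ₀ : ℝ) (x : EuclideanSpace ℝ (Fin d)) (t : ℝ) :
    HasDerivAt (fun ε : ℝ => shellTest β w ψ δ τ₀ (x + ε • -(β (‖x‖ ^ 2) • x)) (t + ε))
      (-2 * (‖x‖ ^ 2 * β (‖x‖ ^ 2) * deriv w (‖x‖ ^ 2)) * ψ (straighten β δ τ₀ t x) +
        w (‖x‖ ^ 2) * ((1 - β (‖x‖ ^ 2) / max (β (‖x‖ ^ 2)) δ) *
          fderiv ℝ ψ (straighten β δ τ₀ t x) (straighten β δ τ₀ t x))) 0 := by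
  by_cases hx : x = 0
  · subst hx
    simpa [shellTest, hw0] using hasDerivAt_const (0 : ℝ) (0 : ℝ)
  · have h1 := hasDerivAt_radial_along hw x (β (‖x‖ ^ 2))
    have h2 : HasFDerivAt ψ (fderiv ℝ ψ (straighten β δ τ₀ t x))
        (straighten β δ τ₀ (t + 0) (x + (0 : ℝ) • -(β (‖x‖ ^ 2) • x))) := by
      simpa using (hψ.differentiable one_ne_zero (straighten β δ τ₀ t x)).hasFDerivAt
    have h3 := h2.comp_hasDerivAt (0 : ℝ) (hasDerivAt_straighten_along hβ_cont hδ τ₀ t hx)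
    refine (h1.mul h3).congr_deriv ?_
    simp

end

/-! ### Uniqueness on each radial piece -/

section

variable {d : ℕ} {T : ℝ} {β : ℝ → ℝ}

theorem LocallyBoundedMeasure.apply_eq_of_subset_sUnion {X : Type*} [PseudoMetricSpace X]
    [MeasurableSpace X] {m m' : LocallyBoundedMeasure X} {𝓔 : Set (Set X)} (hc : 𝓔.Countable)
    (hm : ∀ E ∈ 𝓔, MeasurableSet E)
    (h : ∀ E ∈ 𝓔, ∀ B ⊆ E, MeasurableSet B → Bornology.IsBounded B → m B = m' B) {B : Set X}
    (hB : MeasurableSet B) (hBb : Bornology.IsBounded B) (hBE : B ⊆ ⋃₀ 𝓔) : m B = m' B := by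
  rcases 𝓔.eq_empty_or_nonempty with rfl | hne
  · rw [sUnion_empty, subset_empty_iff] at hBE
    rw [hBE, m.apply_empty, m'.apply_empty]
  obtain ⟨e, rfl⟩ := hc.exists_eq_range hne
  have hem : ∀ i, MeasurableSet (e i) := fun i => hm _ (mem_range_self i)
  have hU : ⋃ i, B ∩ disjointed e i = B := by
    rw [← inter_iUnion, iUnion_disjointed, ← sUnion_range, inter_eq_left.2 hBE]
  have hmd : ∀ i, MeasurableSet (B ∩ disjointed e i) := fun i =>
    hB.inter (MeasurableSet.disjointed hem i)
  have hs : ∀ p : LocallyBoundedMeasure X, HasSum (fun i => p (B ∩ disjointed e i)) (p B) := by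
    intro p
    have := p.hasSum_iUnion (fun i => B ∩ disjointed e i) hmd (by rwa [hU])
      (fun i j hij => (disjoint_disjointed e hij).mono inter_subset_right inter_subset_right)
    rwa [hU] at this
  have h1 := hs m
  have heq : ∀ i, m (B ∩ disjointed e i) = m' (B ∩ disjointed e i) := fun i =>
    h _ (mem_range_self i) _ (inter_subset_right.trans (disjointed_subset e i)) (hmd i)
      (hBb.subset inter_subset_left)
  simp only [heq] at h1
  exact h1.unique (hs m')

theorem continuous_comp_norm_sq (hβ_cont : ContinuousOn β (Ici 0)) :
    Continuous fun x : EuclideanSpace ℝ (Fin d) => β (‖x‖ ^ 2) :=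
  hβ_cont.comp_continuous (by fun_prop) fun x => by simp

/-- Moving `x` along its ray to squared radii `r ∈ J` close to `|x|²` gives points outside `Z`
arbitrarily close to `x`. -/
theorem mem_frontier_of_mem_closure {J : Set ℝ} (hJ : ∀ s ∈ J, 0 < s ∧ 0 < β s)
    {x : EuclideanSpace ℝ (Fin d)} (hx : 0 < ‖x‖ ^ 2) (hβx : β (‖x‖ ^ 2) = 0)
    (hxJ : ‖x‖ ^ 2 ∈ closure J) :
    x ∈ frontier {x : EuclideanSpace ℝ (Fin d) | β (‖x‖ ^ 2) = 0} \ {0} := by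
  refine ⟨⟨subset_closure hβx, fun hint => ?_⟩, fun h0 => ?_⟩
  · have hc : ContinuousAt (fun r : ℝ => √(r / ‖x‖ ^ 2) • x) (‖x‖ ^ 2) :=
      Continuous.continuousAt (by fun_prop)
    have hv : √(‖x‖ ^ 2 / ‖x‖ ^ 2) • x = x := by
      rw [div_self hx.ne', Real.sqrt_one, one_smul]
    have hev : ∀ᶠ r in 𝓝 (‖x‖ ^ 2), √(r / ‖x‖ ^ 2) • x ∈
        {x : EuclideanSpace ℝ (Fin d) | β (‖x‖ ^ 2) = 0} := by
      refine hc.eventually_mem ?_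
      rw [hv]
      exact mem_interior_iff_mem_nhds.1 hint
    obtain ⟨r, hrJ, hr⟩ := ((mem_closure_iff_frequently.1 hxJ).and_eventually hev).exists
    have hn : ‖√(r / ‖x‖ ^ 2) • x‖ ^ 2 = r := by
      rw [norm_smul, mul_pow, Real.norm_eq_abs, sq_abs,
        Real.sq_sqrt (div_nonneg (hJ r hrJ).1.le hx.le), div_mul_cancel₀ _ hx.ne']
    rw [mem_ofPred_eq, hn] at hr
    exact (hJ r hrJ).2.ne' hr
  · rw [mem_singleton_iff.1 h0] at hx
    simp at hx

theorem norm_le_of_norm_straighten_le (hβ_cont : ContinuousOn β (Ici 0)) {C : ℝ}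
    (hC : ∀ s, 0 ≤ s → β s ≤ C) (hC0 : 0 < C) {δ τ₀ t M : ℝ} (hδ : 0 < δ) (hδC : δ ≤ C)
    (ht : 0 ≤ t) {x : EuclideanSpace ℝ (Fin d)} (h : ‖straighten β δ τ₀ t x‖ ≤ M) :
    ‖x‖ ≤ √(Real.exp (τ₀ + 2 * C * Real.log (max M 1))) := by
  rcases eq_or_ne x 0 with rfl | hx
  · simp
  rw [norm_straighten δ τ₀ t hx] at h
  have hs : 0 < ‖x‖ ^ 2 := pow_pos (norm_pos_iff.2 hx) 2
  refine Real.le_sqrt_of_sq_le ?_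
  rw [← Real.log_le_iff_le_exp hs]
  -- `max M 1` keeps the logarithm nonnegative, so one bound also covers the points with `log |x|² ≤
  -- τ₀`.
  have hM : 0 ≤ Real.log (max M 1) := Real.log_nonneg (le_max_right _ _)
  rcases le_total (Real.log (‖x‖ ^ 2)) τ₀ with hle | hle
  · have : 0 ≤ 2 * C * Real.log (max M 1) := by positivity
    linarith
  · have h1 := le_travelTime hβ_cont hC hδ hδC hle
    have h2 : t + travelTime β δ τ₀ (Real.log (‖x‖ ^ 2)) ≤ Real.log (max M 1) := by
      rw [Real.le_log_iff_exp_le (lt_max_of_lt_right one_pos)]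
      exact h.trans (le_max_left _ _)
    have h3 : (Real.log (‖x‖ ^ 2) - τ₀) / (2 * C) ≤ Real.log (max M 1) := by linarith
    rw [div_le_iff₀ (by positivity)] at h3
    linarith

theorem measurable_straighten (hβ_cont : ContinuousOn β (Ici 0)) {δ : ℝ} (hδ : 0 < δ)
    (τ₀ t : ℝ) : Measurable (straighten (d := d) β δ τ₀ t) := by
  have hl : Measurable fun x : EuclideanSpace ℝ (Fin d) => Real.log (‖x‖ ^ 2) :=
    Real.measurable_log.comp (measurable_norm.pow_const 2)
  exact (Real.measurable_exp.comp ((measurable_const.add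
    ((contDiff_travelTime hβ_cont hδ τ₀).continuous.measurable.comp hl)).sub
    (hl.div_const 2))).smul measurable_id

theorem exists_straighten_eq (hβ_cont : ContinuousOn β (Ici 0)) {J : Set ℝ} (hJo : J.OrdConnected)
    (hJ : ∀ s ∈ J, 0 < s ∧ 0 < β s) {σ : ℝ} (hσ : σ ∈ J) {x : EuclideanSpace ℝ (Fin d)}
    (hx : ‖x‖ ^ 2 ∈ J) : ∃ δ₀ > 0, ∀ δ, 0 ≤ δ → δ ≤ δ₀ → ∀ t,
      straighten β δ (Real.log σ) t x = straighten β 0 (Real.log σ) t x := by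
  have hσ0 := (hJ σ hσ).1
  have hx0 := (hJ _ hx).1
  obtain ⟨δ₀, hδ₀, h⟩ := exists_travelTime_eq hβ_cont (τ₀ := Real.log σ)
    (τ := Real.log (‖x‖ ^ 2)) fun r hr => by
      refine (hJ _ (hJo.uIcc_subset hσ hx ?_)).2
      have := Real.exp_monotone.monotoneOn (uIcc (Real.log σ) (Real.log (‖x‖ ^ 2))) |>.image_uIcc_subset
        (mem_image_of_mem _ hr)
      rwa [Real.exp_log hσ0, Real.exp_log hx0] at this
  refine ⟨δ₀, hδ₀, fun δ h0 hδ t => ?_⟩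
  rw [straighten, straighten, h δ h0 hδ]

variable {ν : LocallyBoundedMeasure (EuclideanSpace ℝ (Fin d))}
  {μ₁ μ₂ : LocallyBoundedMeasure (EuclideanSpace ℝ (Fin d) × Icc (0 : ℝ) T)}
  {μt₁ μt₂ : ℝ → LocallyBoundedMeasure (EuclideanSpace ℝ (Fin d))}

theorem measurable_radial_field (hβ_cont : ContinuousOn β (Ici 0)) :
    Measurable fun x : EuclideanSpace ℝ (Fin d) => -(β (‖x‖ ^ 2) • x) :=
  ((continuous_comp_norm_sq hβ_cont).smul continuous_id).neg.measurable

theorem measurableSet_zero_frontier :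
    MeasurableSet (frontier {x : EuclideanSpace ℝ (Fin d) | β (‖x‖ ^ 2) = 0} \ {0}) :=
  isClosed_frontier.measurableSet.diff (measurableSet_singleton 0)

theorem ae_apply_singleton_zero_eq (hT : 0 ≤ T) (hβ_nonneg : ∀ s, 0 ≤ s → 0 ≤ β s)
    (hβ_bdd : ∃ C, ∀ s, 0 ≤ s → β s ≤ C) (hβ_cont : ContinuousOn β (Ici 0))
    (hβ_decr : ∀ N : ℝ, 0 < N → ∃ Λ : ℝ, 0 < Λ ∧ AntitoneOn (fun s => β s - Λ * s) (Icc 0 N))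
    (h₁ : IsCauchySolution (fun x _ => -(β (‖x‖ ^ 2) • x)) ν μ₁ μt₁)
    (h₂ : IsCauchySolution (fun x _ => -(β (‖x‖ ^ 2) • x)) ν μ₂ μt₂) :
    ∀ᵐ t ∂volume.restrict (Icc 0 T), μt₁ t {0} = μt₂ t {0} := by
  obtain ⟨K, hK⟩ := exists_abs_mul_deriv_smoothStep_le hβ_nonneg hβ_bdd hβ_decr le_rfl
    (Or.inl rfl)
  have hε : ∀ n : ℕ, 0 < 1 / ((n : ℝ) + 1) := fun n => by positivity
  have hε1 : ∀ n : ℕ, 1 / ((n : ℝ) + 1) ≤ 1 := fun n => by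
    rw [div_le_one (by positivity)]
    simp
  have hw : ∀ n : ℕ, ContDiff ℝ 1 fun s => 1 - smoothStep 0 (1 / ((n : ℝ) + 1)) s := fun n =>
    contDiff_const.sub (contDiff_smoothStep _ _)
  have hdw : ∀ (n : ℕ) (s : ℝ), deriv (fun s => 1 - smoothStep 0 (1 / ((n : ℝ) + 1)) s) s =
      -deriv (smoothStep 0 (1 / ((n : ℝ) + 1))) s := fun n s => deriv_const_sub 1
  -- No null set is needed: at the origin the factor `‖x‖ ^ 2` kills the transport derivative,
  -- elsewhere the cutoff is eventually locally constant. The radius `2` works because the step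
  -- equals `1` once `‖x‖ ^ 2 ≥ 2ε`, and `ε ≤ 1`.
  have key := ae_integral_eq_of_tendsto (N := ∅) (R := 2) (C := max 1 (2 * K))
    (u := fun n x _ => 1 - smoothStep 0 (1 / ((n : ℝ) + 1)) (‖x‖ ^ 2))
    (f := fun n x _ => -2 * (‖x‖ ^ 2 * β (‖x‖ ^ 2) *
      -deriv (smoothStep 0 (1 / ((n : ℝ) + 1))) (‖x‖ ^ 2)))
    (v := fun x _ => indicator {0} (fun _ => 1) x)
    hT (measurable_radial_field hβ_cont) h₁ h₂ MeasurableSet.empty (by simp) (by simp)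
    (fun n => (hw n).comp (contDiff_fst.norm_sq ℝ)) (fun n x t _ hx => ?_) (fun n x t _ => ?_)
    (fun x _ t _ => ?_) (fun n x t _ => ?_) (fun n x t _ => ?_) (fun x _ t _ => ?_)
  · filter_upwards [key] with t ht
    rwa [(μt₁ t).integral_indicator_one (measurableSet_singleton _) Bornology.isBounded_singleton,
      (μt₂ t).integral_indicator_one (measurableSet_singleton _)
        Bornology.isBounded_singleton] at ht
  · rw [smoothStep_eq_one (hε n), sub_self]
    nlinarith [hε1 n]
  · have := smoothStep_mem 0 (1 / ((n : ℝ) + 1)) (‖x‖ ^ 2)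
    exact le_max_of_le_left (abs_le.2 ⟨by linarith, by linarith⟩)
  · rcases eq_or_ne x 0 with rfl | hx
    · refine tendsto_const_nhds.congr fun n => ?_
      rw [smoothStep_eq_zero (hε n) (by simpa using (hε n).le)]
      simp
    · rw [indicator_of_notMem (notMem_singleton_iff.2 hx)]
      refine tendsto_const_nhds.congr' ?_
      filter_upwards [eventually_smoothStep_of_lt (pow_pos (norm_pos_iff.2 hx) 2)] with n hn
      rw [hn.1, sub_self]
  · have := hasDerivAt_radial_along (hw n) x (β (‖x‖ ^ 2))
    rwa [hdw] at this
  · refine le_max_of_le_right ?_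
    rw [mul_neg, mul_neg, neg_mul, neg_neg, abs_mul, abs_two]
    exact mul_le_mul_of_nonneg_left (hK _ _ (hε n) (hε1 n) (by positivity)) two_pos.le
  · rcases eq_or_ne x 0 with rfl | hx
    · simp
    · refine tendsto_const_nhds.congr' ?_
      filter_upwards [eventually_smoothStep_of_lt (pow_pos (norm_pos_iff.2 hx) 2)] with n hn
      rw [hn.2]
      simp

theorem ae_eq_on_interior_zero (hT : 0 ≤ T) (hβ_cont : ContinuousOn β (Ici 0))
    (h₁ : IsCauchySolution (fun x _ => -(β (‖x‖ ^ 2) • x)) ν μ₁ μt₁)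
    (h₂ : IsCauchySolution (fun x _ => -(β (‖x‖ ^ 2) • x)) ν μ₂ μt₂) :
    ∀ᵐ t ∂volume.restrict (Icc 0 T),
      ∀ B ⊆ interior {x : EuclideanSpace ℝ (Fin d) | β (‖x‖ ^ 2) = 0},
      MeasurableSet B → Bornology.IsBounded B → μt₁ t B = μt₂ t B := by
  set Z : Set (EuclideanSpace ℝ (Fin d)) := {x | β (‖x‖ ^ 2) = 0} with hZ
  have hZc : IsClosed Z := isClosed_eq (continuous_comp_norm_sq hβ_cont) continuous_const
  refine ae_eq_of_integral_eq (A := interior Z) (O := interior Z) (F := fun _ x => x)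
    isOpen_interior.measurableSet isOpen_interior (fun _ => measurable_id)
    (fun _ => injOn_id _) (fun _ => mapsTo_id _) (fun M => ⟨M, fun t _ x _ hx => hx⟩)
    fun ψ hψ hψc hψZ hψ01 => ?_
  have hind : (interior Z).indicator ψ = ψ := indicator_eq_self.2 hψZ
  rw [hind]
  obtain ⟨R, hR⟩ := hψc.isBounded.subset_closedBall 0
  refine ae_integral_eq_of_tendsto (N := ∅) (R := R) (C := 1) (u := fun _ x _ => ψ x)
    (f := fun _ _ _ => 0) (v := fun x _ => ψ x)
    hT (measurable_radial_field hβ_cont) h₁ h₂ MeasurableSet.empty (by simp) (by simp)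
    (fun n => hψ.comp contDiff_fst) (fun n x t _ hx => ?_) (fun n x t _ => ?_)
    (fun x _ t _ => tendsto_const_nhds) (fun n x t _ => ?_) (fun n x t _ => by simp)
    (fun x _ t _ => tendsto_const_nhds)
  · by_contra hne
    exact (mem_closedBall_zero_iff.1 (hR (subset_tsupport ψ hne))).not_gt hx
  · rw [abs_of_nonneg (hψ01 x).1]
    exact (hψ01 x).2
  -- On `Z` the velocity is zero; off the closed set `Z` the short segment stays where `ψ` vanishes.
  -- Either way the transport derivative is exactly `0`.
  · by_cases hx : x ∈ Z
    · have : β (‖x‖ ^ 2) = 0 := hx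
      simpa [this] using hasDerivAt_const (0 : ℝ) (ψ x)
    · have hc : ContinuousAt (fun ε : ℝ => x + ε • -(β (‖x‖ ^ 2) • x)) 0 :=
        Continuous.continuousAt (by fun_prop)
      have hev : ∀ᶠ ε : ℝ in 𝓝 0, x + ε • -(β (‖x‖ ^ 2) • x) ∈ Zᶜ :=
        hc.eventually_mem (hZc.isOpen_compl.mem_nhds (by simpa using hx))
      refine (hasDerivAt_const (0 : ℝ) (0 : ℝ)).congr_of_eventuallyEq ?_
      filter_upwards [hev] with ε hε
      by_contra hne
      exact hε (interior_subset (hψZ hne))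

/-- The limit of the test functions is `1_A ψ ∘ F_t`, with `F_t` the unregularised straightening
map. The two error terms come from the cutoff, bounded by `2K`, and from the regularisation, bounded
by `sup |Dψ(y) y|`; both vanish in the limit off `∂Z \ {0}`. -/
theorem ae_eq_on_component (hT : 0 ≤ T) (hβ_nonneg : ∀ s, 0 ≤ s → 0 ≤ β s)
    (hβ_bdd : ∃ C, ∀ s, 0 ≤ s → β s ≤ C) (hβ_cont : ContinuousOn β (Ici 0))
    (hβ_decr : ∀ N : ℝ, 0 < N → ∃ Λ : ℝ, 0 < Λ ∧ AntitoneOn (fun s => β s - Λ * s) (Icc 0 N))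
    (h₁ : IsCauchySolution (fun x _ => -(β (‖x‖ ^ 2) • x)) ν μ₁ μt₁)
    (h₂ : IsCauchySolution (fun x _ => -(β (‖x‖ ^ 2) • x)) ν μ₂ μt₂)
    (hz₁ : ∀ᵐ t ∂volume.restrict (Icc 0 T),
      (μt₁ t).variation (frontier {x | β (‖x‖ ^ 2) = 0} \ {0}) = 0)
    (hz₂ : ∀ᵐ t ∂volume.restrict (Icc 0 T),
      (μt₂ t).variation (frontier {x | β (‖x‖ ^ 2) = 0} \ {0}) = 0)
    {σ : ℝ} (hσ : 0 < σ) (hβσ : 0 < β σ) :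
    ∃ J : Set ℝ, IsOpen J ∧ σ ∈ J ∧ ∀ᵐ t ∂volume.restrict (Icc 0 T),
      ∀ B ⊆ {x : EuclideanSpace ℝ (Fin d) | ‖x‖ ^ 2 ∈ J},
      MeasurableSet B → Bornology.IsBounded B → μt₁ t B = μt₂ t B := by
  classical
  obtain ⟨J, w, K, hσJ, hJo, hJc, hJ, hw, hw01, hw0, hK, hwJ, hwJ'⟩ :=
    exists_component_cutoff hβ_nonneg hβ_bdd hβ_cont hβ_decr hσ hβσ
  refine ⟨J, hJo, hσJ, ?_⟩
  obtain ⟨C₀, hC₀⟩ := hβ_bdd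
  set C := max C₀ 1
  have hC : ∀ s, 0 ≤ s → β s ≤ C := fun s hs => (hC₀ s hs).trans (le_max_left _ _)
  have hC0 : 0 < C := lt_max_of_lt_right one_pos
  set τ₀ := Real.log σ
  set δ : ℕ → ℝ := fun n => 1 / ((n : ℝ) + 1)
  have hδ : ∀ n, 0 < δ n := fun n => by positivity
  have hδC : ∀ n, δ n ≤ C := fun n => by
    refine le_trans ?_ (le_max_right C₀ 1)
    rw [div_le_one (by positivity)]
    simp
  have hδ0 : ∀ r > 0, ∀ᶠ n in atTop, δ n ≤ r := fun r hr =>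
    (tendsto_one_div_add_atTop_nhds_zero_nat.eventually (gt_mem_nhds hr)).mono fun _ h => h.le
  set A : Set (EuclideanSpace ℝ (Fin d)) := {x | ‖x‖ ^ 2 ∈ J} with hAdef
  have hA : MeasurableSet A := (hJo.preimage (by fun_prop : Continuous fun x :
    EuclideanSpace ℝ (Fin d) => ‖x‖ ^ 2)).measurableSet
  have hA0 : ∀ x ∈ A, x ≠ 0 := fun x hx h => by
    have := (hJ _ hx).1
    simp [h] at this
  have hstab : ∀ x ∈ A, ∀ᶠ n in atTop, ∀ t,
      straighten β (δ n) τ₀ t x = straighten β 0 τ₀ t x := fun x hx => by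
    obtain ⟨δ₀, hδ₀, h⟩ := exists_straighten_eq hβ_cont hJc hJ hσJ hx
    filter_upwards [hδ0 δ₀ hδ₀] with n hn t using h _ (hδ n).le hn t
  -- With `δ = 0` the map is meaningful only on the shell. Cut off by `A`, it is the pointwise limit
  -- of regularised maps that are eventually equal to it, from which it inherits measurability,
  -- injectivity and the norm bound.
  set F : ℝ → EuclideanSpace ℝ (Fin d) → EuclideanSpace ℝ (Fin d) := fun t =>
    A.indicator (straighten β 0 τ₀ t) with hF
  refine ae_eq_of_integral_eq (A := A) (O := univ) (F := F) hA isOpen_univ (fun t => ?_)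
    (fun t x hx y hy hxy => ?_) (fun _ _ _ => mem_univ _) (fun M => ?_) fun ψ hψ hψc _ hψ01 => ?_
  · refine measurable_of_tendsto_metrizable
      (fun n => (measurable_straighten hβ_cont (hδ n) τ₀ t).indicator hA)
      (tendsto_pi_nhds.2 fun x => ?_)
    by_cases hx : x ∈ A
    · simp only [hF, indicator_of_mem hx]
      exact tendsto_const_nhds.congr' ((hstab x hx).mono fun n hn => (hn t).symm)
    · simp only [hF, indicator_of_notMem hx]
      exact tendsto_const_nhds
  · simp only [hF, indicator_of_mem hx, indicator_of_mem hy] at hxy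
    obtain ⟨n, hnx, hny⟩ := ((hstab x hx).and (hstab y hy)).exists
    rw [← hnx, ← hny] at hxy
    exact straighten_injOn hβ_cont (hδ n) τ₀ t (hA0 x hx) (hA0 y hy) hxy
  · refine ⟨√(Real.exp (τ₀ + 2 * C * Real.log (max M 1))), fun t ht x hx hM => ?_⟩
    obtain ⟨n, hn⟩ := (hstab x hx).exists
    simp only [hF, indicator_of_mem hx] at hM
    rw [← hn] at hM
    exact norm_le_of_norm_straighten_le hβ_cont hC hC0 (hδ n) (hδC n) ht.1 hM
  obtain ⟨M, hM⟩ := hψc.isBounded.subset_closedBall 0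
  obtain ⟨K', hK'⟩ : ∃ K', ∀ y, |fderiv ℝ ψ y y| ≤ K' := by
    refine Continuous.bounded_above_of_compact_support (f := fun y => fderiv ℝ ψ y y)
      ((hψ.continuous_fderiv one_ne_zero).clm_apply continuous_id) ?_
    refine (hψc.fderiv (𝕜 := ℝ)).mono fun y hy h0 => hy ?_
    simp only [h0, zero_apply]
  have hK0 : 0 ≤ K := (abs_nonneg _).trans (hK 0 0 le_rfl)
  have hw00 : ∀ n, w n 0 = 0 := fun n => by
    obtain ⟨ε, hε, h⟩ := hw0 n
    exact h 0 hε
  refine ae_integral_eq_of_tendsto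
    (R := √(Real.exp (τ₀ + 2 * C * Real.log (max M 1)))) (C := max 1 (2 * K + K'))
    (u := fun n => shellTest β (w n) ψ (δ n) τ₀)
    (v := fun x t => A.indicator (fun x => ψ (F t x)) x)
    hT (measurable_radial_field hβ_cont) h₁ h₂ measurableSet_zero_frontier hz₁ hz₂
    (fun n => contDiff_shellTest hβ_cont (hw n) (hw0 n) hψ (hδ n) τ₀)
    (fun n x t ht hx => ?_) (fun n x t _ => ?_) (fun x hxN t _ => ?_)
    (fun n x t _ => hasDerivAt_shellTest_along hβ_cont (hw n) (hw00 n) hψ (hδ n) τ₀ x t)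
    (fun n x t _ => ?_) (fun x hxN t _ => ?_)
  · have : ψ (straighten β (δ n) τ₀ t x) = 0 := by
      by_contra hne
      exact (norm_le_of_norm_straighten_le hβ_cont hC hC0 (hδ n) (hδC n) ht.1
        (mem_closedBall_zero_iff.1 (hM (subset_tsupport ψ hne)))).not_gt hx
    rw [shellTest, this, mul_zero]
  · refine le_max_of_le_left ?_
    rw [shellTest, abs_of_nonneg (mul_nonneg (hw01 n _).1 (hψ01 _).1)]
    exact mul_le_one₀ (hw01 n _).2 (hψ01 _).1 (hψ01 _).2
  · by_cases hx : x ∈ A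
    · simp only [indicator_of_mem hx, hF]
      refine tendsto_const_nhds.congr' ?_
      filter_upwards [hstab x hx, hwJ _ hx] with n hn hn'
      rw [shellTest, hn, hn'.1, one_mul]
    · rw [indicator_of_notMem hx]
      rcases hwJ' _ hx with h | ⟨h1, h2, h3⟩
      · refine tendsto_const_nhds.congr' ?_
        filter_upwards [h] with n hn
        rw [shellTest, hn.1, zero_mul]
      · exact absurd (mem_frontier_of_mem_closure hJ h1 h2 h3) hxN
  · refine le_max_of_le_right ((abs_add_le _ _).trans (add_le_add ?_ ?_))
    · rw [abs_mul, abs_mul, abs_neg, abs_two, abs_of_nonneg (hψ01 _).1]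
      exact (mul_le_of_le_one_right (by positivity) (hψ01 _).2).trans
        (mul_le_mul_of_nonneg_left (hK n _ (by positivity)) two_pos.le)
    · have hβx := hβ_nonneg (‖x‖ ^ 2) (by positivity)
      have hm : 0 < max (β (‖x‖ ^ 2)) (δ n) := lt_max_of_lt_right (hδ n)
      have hq : β (‖x‖ ^ 2) / max (β (‖x‖ ^ 2)) (δ n) ≤ 1 :=
        (div_le_one hm).2 (le_max_left _ _)
      have hq0 : 0 ≤ β (‖x‖ ^ 2) / max (β (‖x‖ ^ 2)) (δ n) := div_nonneg hβx hm.le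
      rw [abs_mul, abs_mul, abs_of_nonneg (hw01 n _).1, abs_of_nonneg (by linarith)]
      exact (mul_le_of_le_one_left (mul_nonneg (by linarith) (abs_nonneg _)) (hw01 n _).2).trans
        ((mul_le_of_le_one_left (abs_nonneg _) (by linarith)).trans (hK' _))
  · by_cases hx : x ∈ A
    · refine tendsto_const_nhds.congr' ?_
      -- Once `δ n ≤ β(|x|²)` the conservation law is exact, and the cutoff is already flat at
      -- `|x|²`.
      filter_upwards [hδ0 _ (hJ _ hx).2, hwJ _ hx] with n hn hn'
      rw [hn'.2, max_eq_left hn, div_self (hJ _ hx).2.ne']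
      simp
    · rcases hwJ' _ hx with h | ⟨h1, h2, h3⟩
      · refine tendsto_const_nhds.congr' ?_
        filter_upwards [h] with n hn
        rw [hn.1, hn.2]
        simp
      · exact absurd (mem_frontier_of_mem_closure hJ h1 h2 h3) hxN

end

/-! ### Assembling the pieces -/

theorem mainTheorem6 (d : ℕ) (T : ℝ) (hT : 0 < T) (β : ℝ → ℝ)
    (hβ_nonneg : ∀ s, 0 ≤ s → 0 ≤ β s)
    (hβ_bdd : ∃ C, ∀ s, 0 ≤ s → β s ≤ C)
    (hβ_cont : ContinuousOn β (Ici 0))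
    (hβ_decr : ∀ N : ℝ, 0 < N → ∃ Λ : ℝ, 0 < Λ ∧ AntitoneOn (fun s => β s - Λ * s) (Icc 0 N))
    (ν : LocallyBoundedMeasure (EuclideanSpace ℝ (Fin d)))
    (μ₁ μ₂ : LocallyBoundedMeasure (EuclideanSpace ℝ (Fin d) × Icc (0 : ℝ) T))
    (μt₁ μt₂ : ℝ → LocallyBoundedMeasure (EuclideanSpace ℝ (Fin d)))
    (h₁ : IsCauchySolution (fun x _ => -(β (‖x‖ ^ 2) • x)) ν μ₁ μt₁)
    (h₂ : IsCauchySolution (fun x _ => -(β (‖x‖ ^ 2) • x)) ν μ₂ μt₂)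
    (hz₁ : ∀ᵐ t ∂volume.restrict (Icc 0 T),
      (μt₁ t).variation (frontier {x | β (‖x‖ ^ 2) = 0} \ {0}) = 0)
    (hz₂ : ∀ᵐ t ∂volume.restrict (Icc 0 T),
      (μt₂ t).variation (frontier {x | β (‖x‖ ^ 2) = 0} \ {0}) = 0) :
    μ₁ = μ₂ ∧ ∀ᵐ t ∂volume.restrict (Icc 0 T), μt₁ t = μt₂ t := by
  have hE : ∀ᵐ t ∂volume.restrict (Icc 0 T), μt₁ t = μt₂ t := by
    have hJ := fun (σ : ℝ) (hσ : σ ∈ {σ : ℝ | 0 < σ ∧ 0 < β σ}) => ae_eq_on_component hT.le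
      hβ_nonneg hβ_bdd hβ_cont hβ_decr h₁ h₂ hz₁ hz₂ hσ.1 hσ.2
    choose! J hJo hσJ hJ using hJ
    -- Lindelöf: countably many of the open sets `J σ` cover the union, so the exceptional times of
    -- the chosen shells form a null set.
    obtain ⟨S, hS, hSc, hSU⟩ := TopologicalSpace.isOpen_biUnion_countable
      {σ : ℝ | 0 < σ ∧ 0 < β σ} J hJo
    filter_upwards [ae_apply_singleton_zero_eq hT.le hβ_nonneg hβ_bdd hβ_cont hβ_decr h₁ h₂,
      ae_eq_on_interior_zero hT.le hβ_cont h₁ h₂, hz₁, hz₂,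
      (ae_ball_iff hSc).2 fun σ hσ => hJ σ (hS hσ)] with t ht0 htZ hn₁ hn₂ htJ
    refine LocallyBoundedMeasure.eq_of_forall fun B hB hBb => ?_
    refine LocallyBoundedMeasure.apply_eq_of_subset_sUnion
      (𝓔 := {{0}, frontier {x | β (‖x‖ ^ 2) = 0} \ {0}, interior {x | β (‖x‖ ^ 2) = 0}} ∪
        (fun σ => {x : EuclideanSpace ℝ (Fin d) | ‖x‖ ^ 2 ∈ J σ}) '' S)
      ((Set.toFinite _).countable.union (hSc.image _)) ?_ ?_ hB hBb fun x _ => ?_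
    · rintro E ((rfl | rfl | rfl) | ⟨σ, hσ, rfl⟩)
      · exact measurableSet_singleton 0
      · exact measurableSet_zero_frontier
      · exact isOpen_interior.measurableSet
      · exact ((hJo σ (hS hσ)).preimage (by fun_prop : Continuous fun x :
          EuclideanSpace ℝ (Fin d) => ‖x‖ ^ 2)).measurableSet
    · rintro E ((rfl | rfl | rfl) | ⟨σ, hσ, rfl⟩) B' hB'E hB' hBb'
      · rcases subset_singleton_iff_eq.1 hB'E with rfl | rfl
        · rw [(μt₁ t).apply_empty, (μt₂ t).apply_empty]
        · exact ht0
      · rw [(μt₁ t).apply_eq_zero_of_variation hn₁ hB' hBb' hB'E,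
          (μt₂ t).apply_eq_zero_of_variation hn₂ hB' hBb' hB'E]
      · exact htZ B' hB'E hB' hBb'
      · exact htJ σ hσ B' hB'E hB' hBb'
    · by_cases hx0 : x = 0
      · exact ⟨{0}, Or.inl (Or.inl rfl), hx0⟩
      by_cases hxZ : β (‖x‖ ^ 2) = 0
      · by_cases hxi : x ∈ interior {x : EuclideanSpace ℝ (Fin d) | β (‖x‖ ^ 2) = 0}
        · exact ⟨_, Or.inl (Or.inr (Or.inr rfl)), hxi⟩
        · exact ⟨_, Or.inl (Or.inr (Or.inl rfl)), ⟨subset_closure hxZ, hxi⟩, hx0⟩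
      · have hs : ‖x‖ ^ 2 ∈ {σ : ℝ | 0 < σ ∧ 0 < β σ} :=
          ⟨pow_pos (norm_pos_iff.2 hx0) 2,
            lt_of_le_of_ne (hβ_nonneg _ (by positivity)) (Ne.symm hxZ)⟩
        have hmem : ‖x‖ ^ 2 ∈ ⋃ σ ∈ S, J σ := by
          rw [hSU]
          exact mem_biUnion hs (hσJ _ hs)
        obtain ⟨σ, hσS, hxσ⟩ := mem_iUnion₂.1 hmem
        exact ⟨_, Or.inr ⟨σ, hσS, rfl⟩, hxσ⟩
  refine ⟨LocallyBoundedMeasure.eq_of_forall fun A hA hAb => ?_, hE⟩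
  -- A measure given by a family is recovered from its time slices, so equality of almost all slices
  -- suffices.
  rw [h₁.isGivenByFamily.apply_eq hT.le hA hAb, h₂.isGivenByFamily.apply_eq hT.le hA hAb,
    intervalIntegral.integral_of_le hT.le, intervalIntegral.integral_of_le hT.le]
  refine integral_congr_ae ?_
  filter_upwards [ae_mono (Measure.restrict_mono Ioc_subset_Icc_self le_rfl) hE] with t ht
  rw [ht]
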